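/- **Setting.** Signed queue sizes $Q_\ell(t)\in\mathbb Z$ at price levels $\ell\in\{1,\dots,N\}$ (ask queues positive, bid queues negative) form a limit order book with best ask $p_A=\min\{\ell:Q_\ell>0\}$ (or $N+1$), best bid $p_B=\max\{\ell:Q_\ell<0\}$ (or $0$), mid-price $p_M=(p_A+p_B)/2$ and spread $S=p_A-p_B$; paths are right-continuous step functions. Let $\{i,j\}=\{A,B\}$ and $s_0\ge 1$, with $S(0)=s_0$. An order that is never withdrawn rests on side $i$ one level deeper than the best quote; $W_{i-}(t)$ is its queue position (number of remaining orders up to and including it). Let $\tau^{\rm quote}_i$ be the first time the best quote of side $i$ moves away from the opposite side and $\tau_i^{\rm other}$ the first time of any other change of $p_A$ or $p_B$. Fix $m,n\ge 1$ and condition on the event (assumed of positive probability) that $\tau^{\rm quote}_i<\tau^{\rm other}_i$ and that at time $\tau_i^{\rm quote}$ the best quotes are $p'_A$ and $p'_B$ with $p'_A-p'_B=s_0+1$, that $W_{i-}(\tau_i^{\rm quote})=m$, and that the opposite best queue has size $Q_j(\tau_i^{\rm quote})=n$. Write $p_{i-}=p'_i$ and $p_j=p'_j$ for the best quotes of the two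 sides at that time. Let $$\tau^i=\inf\{t\ge\tau_i^{\rm quote}:p_M(t)\ne p_M(\tau_i^{\rm quote})\}-\tau_i^{\rm quote},\qquad \epsilon_{i-}=\inf\{u\ge 0: W_{i-}(\tau_i^{\rm quote}+u)=0\}.$$ **Order flow.** Let $\boldsymbol X_\ell$ be the factor vector at level $\ell$, a function of $\ell$ and the best quotes, and let $\lambda_k,\mu_k,\phi_k\ge 0$ be the limit, market and cancellation intensities (which may depend on the side) at queue size $k$. Conditionally on the above event there are independent: a pure-death process started at $m$ with death rates $\mu_k(\boldsymbol X_{p_{i-}})+\phi_k(\boldsymbol X_{p_{i-}})$; a (non-explosive) birth-death process started at $n$ with birth rates $\lambda_k(\boldsymbol X_{p_j})$ and death rates $\mu_k(\boldsymbol X_{p_j})+\phi_k(\boldsymbol X_{p_j})$, $k\ge1$; and, for $r=1,\dots,s_0$, exponential times of rate $\lambda_0(\boldsymbol X_{p'_A-r})$ (first sell order at level $p'_A-r$) and of rate $\lambda_0(\boldsymbol X_{p'_B+r})$ (first buy order at level $p'_B+r$), a time of rate $0$ being $\infty$. Up to and including the next mid-price move after $\tau_i^{\rm quote}$, the position $W_{i-}$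 equals the first process, the opposite best queue equals the second, each level inside the spread holds sell (buy) orders exactly once its sell (buy) time has passed, the queue at $p_{i-}$ contains at least the $W_{i-}$ orders up to and including the order considered, and there are no sell orders at levels $\le p'_B$ and no buy orders at levels $\ge p'_A$. Assume that the total arrival rate inside the spread is the same on both sides, $$\Lambda'_{s_0+1}=\sum_{r=1}^{s_0}\lambda_0(\boldsymbol X_{p'_A-r})=\sum_{r=1}^{s_0}\lambda_0(\boldsymbol X_{p'_B+r}).$$ Let $\hat g(s)=\mathbb E[e^{-s\epsilon};\epsilon<\infty]$ and $\hat f(s)=\mathbb E[e^{-s\sigma_j};\sigma_j<\infty]$ be the Laplace transforms of the first-passage times to $0$, $\epsilon$ of the pure-death process (from $m$) and $\sigma_j$ of the birth-death process (from $n$), and put $$\hat F(s)=\frac1s\,\hat g(s)\left(\hat f(2\Lambda'_{s_0+1}-s)+\frac{2\Lambda'_{s_0+1}}{2\Lambda'_{s_0+1}-s}\bigl(1-\hat f(2\Lambda'_{s_0+1}-s)\bigr)\right).$$ **Proposition.** Let $c>0$ be such that either $c<2\Lambda'_{s_0+1}$, or $c>2\Lambda'_{s_0+1}$, $\sigma_j<\infty$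 almost surely and $\mathbb E[e^{(c-2\Lambda'_{s_0+1})\sigma_j}]<\infty$. Then the conditional probability that the order is filled with no earlier mid-price move is the inverse Laplace transform of $\hat F$ evaluated at $0$: $$\mathbb P\bigl[\epsilon_{i-}<\infty,\ \epsilon_{i-}\le\tau^i\mid W_{i-}(\tau_i^{\rm quote})=m,\,Q_j(\tau_i^{\rm quote})=n\bigr]=\lim_{R\to\infty}\frac1{2\pi}\int_{-R}^{R}\hat F(c+iy)\,dy$$ (in $c+iy$, $i$ is the imaginary unit), where $\mathbb P[\,\cdot\mid\cdot\,]$ is conditional on the whole event above and the integrals exist. If, moreover, almost surely under this conditional law the queue at $p_{i-}$ is not empty at the moment of the fill whenever $\epsilon_{i-}<\infty$ and $\epsilon_{i-}\le\tau^i$, then the same limit equals $\mathbb P[\epsilon_{i-}<\tau^i\mid W_{i-}(\tau_i^{\rm quote})=m,\,Q_j(\tau_i^{\rm quote})=n]$. -/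

import Mathlib

open MeasureTheory ProbabilityTheory Filter Topology
open scoped NNReal ENNReal

namespace LimitOrderBook

/-! ### The order book -/

/-- The two sides of the book. -/
inductive Side
  | ask
  | bid

/-- The opposite side. -/
def Side.opp : Side → Side
  | .ask => .bid
  | .bid => .ask

/-- Ask queues are counted positively, bid queues negatively. -/
def Side.sign : Side → ℤ
  | .ask => 1
  | .bid => -1

/-- A book state: the signed queue size at each price level. Only levels `1, …, N` are used. -/
abbrev Book := ℕ → ℤ

/-- Best ask: the lowest level in `{1, …, N}` holding sell orders, and `N + 1` if there is none. -/
noncomputable def bestAsk (N : ℕ) (x : Book) : ℕ :=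
  sInf ({l | 1 ≤ l ∧ l ≤ N ∧ 0 < x l} ∪ {N + 1})

/-- Best bid: the highest level in `{1, …, N}` holding buy orders, and `0` if there is none. -/
noncomputable def bestBid (N : ℕ) (x : Book) : ℕ :=
  sSup ({l | 1 ≤ l ∧ l ≤ N ∧ x l < 0} ∪ {0})

/-- The mid-price. -/
noncomputable def midPrice (N : ℕ) (x : Book) : ℝ :=
  ((bestBid N x : ℝ) + (bestAsk N x : ℝ)) / 2

/-- The bid-ask spread. -/
noncomputable def spread (N : ℕ) (x : Book) : ℤ :=
  (bestAsk N x : ℤ) - (bestBid N x : ℤ)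

/-- Among a best ask `a` and a best bid `b`, the quote of the given side. -/
def Side.quote (a b : ℕ) : Side → ℕ
  | .ask => a
  | .bid => b

/-- The level strictly inside the spread which is `r + 1` ticks away from the best quote of the
given side; an order of that side posted there improves that best quote. -/
def Side.insideLevel (a b : ℕ) : Side → ℕ → ℕ
  | .ask, r => a - (r + 1)
  | .bid, r => b + (r + 1)

/-! ### Random times attached to a trajectory -/

/-- `inf {t ≥ 0 : A t}`, equal to `∞` if `A` never holds. -/
noncomputable def firstTime (A : ℝ≥0 → Prop) : ℝ≥0∞ :=
  ⨅ (t : ℝ≥0) (_ : A t), (t : ℝ≥0∞)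

/-- First time the best quote of side `i` moves away from the opposite side
(the ask moves up, respectively the bid moves down). -/
noncomputable def quoteTime (N : ℕ) : Side → (ℝ≥0 → Book) → ℝ≥0∞
  | .ask, x => firstTime fun t => bestAsk N (x 0) < bestAsk N (x t)
  | .bid, x => firstTime fun t => bestBid N (x t) < bestBid N (x 0)

/-- First time of any other change of the best quotes. -/
noncomputable def otherTime (N : ℕ) : Side → (ℝ≥0 → Book) → ℝ≥0∞
  | .ask, x => firstTime fun t =>
      bestAsk N (x t) < bestAsk N (x 0) ∨ bestBid N (x t) ≠ bestBid N (x 0)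
  | .bid, x => firstTime fun t =>
      bestBid N (x 0) < bestBid N (x t) ∨ bestAsk N (x t) ≠ bestAsk N (x 0)

variable {Ω : Type*}

/-- The quote time `τ_quote` as a clock value (used only where it is finite). -/
noncomputable def quoteClock (N : ℕ) (i : Side) (Q : ℝ≥0 → Ω → Book) (ω : Ω) : ℝ≥0 :=
  (quoteTime N i fun t => Q t ω).toNNReal

/-- The book `u` units of time after the quote time. -/
noncomputable def shiftedBook (N : ℕ) (i : Side) (Q : ℝ≥0 → Ω → Book) (u : ℝ≥0) (ω : Ω) : Book :=
  Q (quoteClock N i Q ω + u) ω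

/-- The order's queue position `u` units of time after the quote time. -/
noncomputable def shiftedPosition (N : ℕ) (i : Side) (Q : ℝ≥0 → Ω → Book) (W : ℝ≥0 → Ω → ℕ)
    (u : ℝ≥0) (ω : Ω) : ℕ :=
  W (quoteClock N i Q ω + u) ω

/-- `τ^i`: the time from `τ_quote` to the next change of the mid-price. -/
noncomputable def nextMove (N : ℕ) (i : Side) (Q : ℝ≥0 → Ω → Book) (ω : Ω) : ℝ≥0∞ :=
  firstTime fun u => midPrice N (shiftedBook N i Q u ω) ≠ midPrice N (shiftedBook N i Q 0 ω)

/-- `ε_{i-}`: the time from `τ_quote` until the order's queue position reaches `0`. -/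
noncomputable def fillTime (N : ℕ) (i : Side) (Q : ℝ≥0 → Ω → Book) (W : ℝ≥0 → Ω → ℕ)
    (ω : Ω) : ℝ≥0∞ :=
  firstTime fun u => shiftedPosition N i Q W u ω = 0

/-- The conditioning event: the initial spread is `s₀`, the quote of side `i` moves away before
anything else moves the best quotes, and at that time the best ask is `a`, the best bid is `b`,
the order's position is `m` and the opposite best queue has size `n`. -/
def quoteEvent (N : ℕ) (i : Side) (Q : ℝ≥0 → Ω → Book) (W : ℝ≥0 → Ω → ℕ)
    (s₀ a b m n : ℕ) : Set Ω :=
  {ω | spread N (Q 0 ω) = s₀ ∧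
    quoteTime N i (fun t => Q t ω) < otherTime N i (fun t => Q t ω) ∧
    bestAsk N (shiftedBook N i Q 0 ω) = a ∧
    bestBid N (shiftedBook N i Q 0 ω) = b ∧
    shiftedPosition N i Q W 0 ω = m ∧
    (shiftedBook N i Q 0 ω (i.opp.quote a b)).natAbs = n}

/-! ### Birth-death processes, pure-death processes and exponential clocks -/

/-- The generator of the birth-death process on `ℕ` with birth rates `β k` and death rates `δ k`
(no death from state `0`). -/
def birthDeathGenerator (β δ : ℕ → ℝ≥0) (x y : ℕ) : ℝ :=
  if y = x + 1 then β x
  else if x = y + 1 then δ x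
  else if x = y then -((β x : ℝ) + if x = 0 then 0 else (δ x : ℝ))
  else 0

/-- `p` is an honest transition function on `ℕ` whose derivative at time `0` is `q`. -/
structure IsTransitionFunction (p : ℝ≥0 → ℕ → ℕ → ℝ) (q : ℕ → ℕ → ℝ) : Prop where
  nonneg : ∀ t x y, 0 ≤ p t x y
  hasSum_one : ∀ t x, HasSum (p t x) 1
  zero : ∀ x y, p 0 x y = if x = y then 1 else 0
  chapman_kolmogorov : ∀ s t x z, HasSum (fun y => p s x y * p t y z) (p (s + t) x z)
  deriv_zero : ∀ x y,
    Tendsto (fun h : ℝ≥0 => (p h x y - p 0 x y) / (h : ℝ)) (𝓝[>] 0) (𝓝 (q x y))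

/-- `Z` is a time-homogeneous continuous-time Markov chain on `ℕ` with generator `q`, started at
`x₀`. Its paths are right-continuous with left limits in the discrete space `ℕ`, so that it makes
finitely many jumps in bounded time. -/
structure IsMarkovJumpProcess [MeasurableSpace Ω] (P : Measure Ω) (Z : ℝ≥0 → Ω → ℕ) (x₀ : ℕ)
    (q : ℕ → ℕ → ℝ) : Prop where
  measurable : ∀ t, Measurable (Z t)
  start : ∀ᵐ ω ∂P, Z 0 ω = x₀
  right_continuous : ∀ ω t, ∀ᶠ u in 𝓝[>] t, Z u ω = Z t ω
  left_limit : ∀ ω t, 0 < t → ∃ x, ∀ᶠ u in 𝓝[<] t, Z u ω = x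
  markov : ∃ p, IsTransitionFunction p q ∧
    ∀ (s t : ℝ≥0) (x y : ℕ) (A : Set Ω),
      MeasurableSet[⨆ (u : ℝ≥0) (_ : u ≤ s), MeasurableSpace.comap (Z u) ⊤] A →
      P.real (A ∩ {ω | Z s ω = x} ∩ {ω | Z (s + t) ω = y})
        = P.real (A ∩ {ω | Z s ω = x}) * p t x y

/-- Birth-death process with birth rates `β`, death rates `δ`, started at `x₀`. -/
def IsBirthDeathProcess [MeasurableSpace Ω] (P : Measure Ω) (Z : ℝ≥0 → Ω → ℕ) (x₀ : ℕ)
    (β δ : ℕ → ℝ≥0) : Prop :=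
  IsMarkovJumpProcess P Z x₀ (birthDeathGenerator β δ)

/-- Pure-death process with death rates `δ`, started at `x₀`. -/
def IsPureDeathProcess [MeasurableSpace Ω] (P : Measure Ω) (Z : ℝ≥0 → Ω → ℕ) (x₀ : ℕ)
    (δ : ℕ → ℝ≥0) : Prop :=
  IsMarkovJumpProcess P Z x₀ (birthDeathGenerator (fun _ => 0) δ)

/-- First passage time to `0`. -/
noncomputable def passageTime (Z : ℝ≥0 → Ω → ℕ) (ω : Ω) : ℝ≥0∞ :=
  firstTime fun t => Z t ω = 0

/-- `T` is exponentially distributed with the given rate (rate `0`: `T = ∞` almost surely). -/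
structure IsExponentialTime [MeasurableSpace Ω] (P : Measure Ω) (T : Ω → ℝ≥0∞) (rate : ℝ≥0) :
    Prop where
  measurable : Measurable T
  tail : ∀ t : ℝ≥0, P.real {ω | (t : ℝ≥0∞) < T ω} = Real.exp (-(rate * t))

/-! ### Order flow after the quote time -/

/-- State-dependent intensities of limit orders, market orders and cancellations, by side, size of
the queue concerned, and value of the factor vector at its price level. -/
structure Intensities (𝒳 : Type*) where
  lam : Side → ℕ → 𝒳 → ℝ≥0
  mu : Side → ℕ → 𝒳 → ℝ≥0
  phi : Side → ℕ → 𝒳 → ℝ≥0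

/-- Labels of the independent sources of randomness. -/
inductive Driver (s₀ : ℕ)
  | position
  | opposite
  | arrival (k : Side) (r : Fin s₀)

/-- The information generated by each source of randomness. -/
@[reducible] def driverSigma {s₀ : ℕ} (D B : ℝ≥0 → Ω → ℕ) (T : Side → Fin s₀ → Ω → ℝ≥0∞) :
    Driver s₀ → MeasurableSpace Ω
  | .position => ⨆ t, MeasurableSpace.comap (D t) ⊤
  | .opposite => ⨆ t, MeasurableSpace.comap (B t) ⊤
  | .arrival k r => MeasurableSpace.comap (T k r) inferInstance

/-- The order flow after the quote time, under the conditional law `P` of the model given the state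
at that time (best ask `a`, best bid `b`, order's position `m`, opposite best queue `n`).

`X l a b` is the factor vector at level `l` while the best quotes are `a` and `b`.
Independently of each other, `D` drives the order's position, `B` drives the opposite best queue,
and `T k r` is the first arrival of an order of side `k` at the level inside the spread which is
`r + 1` ticks from the best quote of side `k`. They govern the book up to and including the next
mid-price move; nothing is required of the book after that move. -/
structure PostQuoteFlow [MeasurableSpace Ω] {𝒳 : Type*} (P : Measure Ω) (N : ℕ) (i : Side)
    (Q : ℝ≥0 → Ω → Book) (W : ℝ≥0 → Ω → ℕ) (R : Intensities 𝒳) (X : ℕ → ℕ → ℕ → 𝒳)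
    (s₀ a b m n : ℕ) (D B : ℝ≥0 → Ω → ℕ) (T : Side → Fin s₀ → Ω → ℝ≥0∞) : Prop where
  /-- The order, at the new best quote, advances by market orders and cancellations. -/
  position_law : IsPureDeathProcess P D m
    (fun k => R.mu i k (X (i.quote a b) a b) + R.phi i k (X (i.quote a b) a b))
  /-- The opposite best queue is a birth-death process. -/
  opposite_law : IsBirthDeathProcess P B n
    (fun k => R.lam i.opp k (X (i.opp.quote a b) a b))
    (fun k => R.mu i.opp k (X (i.opp.quote a b) a b) + R.phi i.opp k (X (i.opp.quote a b) a b))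
  /-- Orders arrive at the empty levels inside the spread at exponential times. -/
  arrival_law : ∀ k r, IsExponentialTime P (T k r) (R.lam k 0 (X (k.insideLevel a b r) a b))
  independent : iIndep (driverSigma D B T) P
  position_eq : ∀ᵐ ω ∂P, ∀ u : ℝ≥0, (u : ℝ≥0∞) ≤ nextMove N i Q ω →
    shiftedPosition N i Q W u ω = D u ω
  opposite_eq : ∀ᵐ ω ∂P, ∀ u : ℝ≥0, (u : ℝ≥0∞) ≤ nextMove N i Q ω →
    shiftedBook N i Q u ω (i.opp.quote a b) = i.opp.sign * (B u ω : ℤ)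
  /-- A level inside the spread holds orders of side `k` once such an order has arrived. -/
  inside_iff : ∀ᵐ ω ∂P, ∀ u : ℝ≥0, (u : ℝ≥0∞) ≤ nextMove N i Q ω → ∀ k r,
    (0 < k.sign * shiftedBook N i Q u ω (k.insideLevel a b r) ↔ T k r ω ≤ u)
  /-- The orders up to and including the concerned order are part of the queue at its level;
  there may be further ones behind it. -/
  own_queue : ∀ᵐ ω ∂P, ∀ u : ℝ≥0, (u : ℝ≥0∞) ≤ nextMove N i Q ω →
    (D u ω : ℤ) ≤ i.sign * shiftedBook N i Q u ω (i.quote a b)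
  /-- No sell order is posted at or below the bid and no buy order at or above the ask. -/
  no_crossing : ∀ᵐ ω ∂P, ∀ u : ℝ≥0, (u : ℝ≥0∞) ≤ nextMove N i Q ω → ∀ l,
    (l ≤ b → shiftedBook N i Q u ω l ≤ 0) ∧ (a ≤ l → 0 ≤ shiftedBook N i Q u ω l)

/-! ### Laplace transforms -/

/-- Laplace transform of the (possibly defective) law of a random time `T` on `[0, ∞)`. -/
noncomputable def laplace [MeasurableSpace Ω] (P : Measure Ω) (T : Ω → ℝ≥0∞) (s : ℂ) : ℂ :=
  ∫ ω in {ω | T ω < ∞}, Complex.exp (-s * ((T ω).toReal : ℂ)) ∂P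

/-- The inverse Laplace transform of `F` along the line `Re s = c`, evaluated at `t`, exists and
equals `v`: the Bromwich integral converges to `v` as a symmetric limit. -/
def HasInverseLaplaceAt (F : ℂ → ℂ) (c t : ℝ) (v : ℂ) : Prop :=
  (∀ r : ℝ, IntervalIntegrable
    (fun y : ℝ => Complex.exp ((c + y * Complex.I) * t) * F (c + y * Complex.I)) volume (-r) r) ∧
  Tendsto (fun r : ℝ => (1 / (2 * Real.pi) : ℂ) *
      ∫ y in (-r)..r, Complex.exp ((c + y * Complex.I) * t) * F (c + y * Complex.I))
    atTop (𝓝 v)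

/-- `(1/s) ĝ(s) ( f̂(2Λ - s) + 2Λ/(2Λ - s) (1 - f̂(2Λ - s)) )`. -/
noncomputable def fillTransform (g f : ℂ → ℂ) (Λ : ℝ) (s : ℂ) : ℂ :=
  (1 / s) * g s *
    (f (2 * Λ - s) + (2 * Λ) / (2 * Λ - s) * (1 - f (2 * Λ - s)))

end LimitOrderBook

open LimitOrderBook

namespace LimitOrderBook

/-! While the order is unfilled its own level is nonempty, so the mid-price can move only through
the opposite queue emptying or an order arriving inside the spread. Let `M` be the first of these
times and `ε` the passage time of the position process. All the times are independent, and enough of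
them have no atoms to rule out the relevant ties almost surely. At `M` exactly one best quote
therefore moves, and the mid-price really changes. Path by path, "filled no later than the next
move" becomes `ε < M` (`IsDrivenPath.fill_le_nextMid_iff`). The fill can coincide with the next move
only by emptying the order's level, which gives the strict version
(`IsDrivenPath.fill_lt_nextMid_iff`).

It remains to compute the probability of `ε < M`. The arrivals on the two sides have total rate
`2Λ`, so `M` has tail `P(σ > t) exp (-2Λt)`. Integrating by parts (`laplace_neg_sub_one_eq`) once
for `M` and once for `σ` shows that the bracket in `fillTransform` is `E[exp (sM)]`. By independence
the whole transform is `(1/s) E[exp (s(M - ε)); ε < ∞]`, a bilateral Laplace transform divided by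
`s`.

Bromwich inversion at `0` then extracts the mass of `M - ε > 0` (`hasInverseLaplaceAt_zero`). By
Fubini the truncated integral is the expectation of `bromwichKernel` at `x = M - ε`. As `r → ∞` the
kernel tends to `2π` for `x > 0` and to `0` for `x < 0`. It is bounded by a constant times `exp
(cx)` uniformly in `r ≥ 1` (`norm_bromwichKernel_le`), so dominated convergence applies. At `x = 0`
the limit would be `π`; this is why ties must be null. -/

/-! ### The Bromwich kernel -/

/-- The truncated Bromwich integral of `exp (s x) / s` along the line `Re s = c`. -/
noncomputable def bromwichKernel (c x r : ℝ) : ℂ :=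
  ∫ y in (-r)..r, Complex.exp ((c + y * Complex.I) * x) / (c + y * Complex.I)

lemma line_ne_zero {c : ℝ} (hc : c ≠ 0) (y : ℝ) : (c + y * Complex.I : ℂ) ≠ 0 := fun h =>
  hc (by simpa using congrArg Complex.re h)

lemma continuous_bromwich_integrand {c : ℝ} (hc : c ≠ 0) (x : ℝ) :
    Continuous fun y : ℝ => Complex.exp ((c + y * Complex.I) * x) / (c + y * Complex.I) :=
  Continuous.div (by fun_prop) (by fun_prop) (line_ne_zero hc)

lemma norm_exp_mul_ofReal (s : ℂ) (x : ℝ) : ‖Complex.exp (s * x)‖ = Real.exp (s.re * x) := by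
  simp [Complex.norm_exp]

lemma norm_bromwich_integrand_le_re {c : ℝ} (hc : 0 < c) (x y : ℝ) :
    ‖Complex.exp ((c + y * Complex.I) * x) / (c + y * Complex.I)‖ ≤ Real.exp (c * x) / c := by
  rw [norm_div, norm_exp_mul_ofReal]
  have h : c ≤ ‖(c + y * Complex.I : ℂ)‖ := by
    simpa [abs_of_pos hc] using Complex.abs_re_le_norm (c + y * Complex.I : ℂ)
  simp only [Complex.add_re, Complex.ofReal_re, Complex.mul_re, Complex.I_re, mul_zero,
    Complex.ofReal_im, Complex.I_im, mul_one, sub_self, add_zero]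
  gcongr

lemma norm_bromwich_integrand_le_im {v : ℝ} (hv : v ≠ 0) (u x : ℝ) :
    ‖Complex.exp ((u + v * Complex.I) * x) / (u + v * Complex.I)‖ ≤ Real.exp (u * x) / |v| := by
  rw [norm_div, norm_exp_mul_ofReal]
  have h : |v| ≤ ‖(u + v * Complex.I : ℂ)‖ := by
    simpa using Complex.abs_im_le_norm (u + v * Complex.I : ℂ)
  have hv' : 0 < |v| := abs_pos.mpr hv
  simp only [Complex.add_re, Complex.ofReal_re, Complex.mul_re, Complex.I_re, mul_zero,
    Complex.ofReal_im, Complex.I_im, mul_one, sub_self, add_zero]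
  gcongr

/-- For `x < 0` the exponential is integrable towards `+∞`, so the bound does not depend on `l`.
This allows the far side of the rectangle to be sent to infinity. -/
lemma norm_integral_horizontal_le {c l v x : ℝ} (hcl : c ≤ l) (hv : v ≠ 0) (hx : x < 0) :
    ‖∫ u in c..l, Complex.exp (((u : ℝ) + v * Complex.I) * x) / (u + v * Complex.I)‖
      ≤ Real.exp (c * x) / (-x * |v|) := by
  have hv' : 0 < |v| := abs_pos.mpr hv
  have h1 : ∫ u in c..l, Real.exp (u * x) / |v| = (Real.exp (l * x) - Real.exp (c * x)) / x / |v| := by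
    rw [intervalIntegral.integral_div, intervalIntegral.integral_comp_mul_right _ hx.ne,
      integral_exp, smul_eq_mul, inv_mul_eq_div]
  have h2 := intervalIntegral.norm_integral_le_of_norm_le (μ := volume) hcl
    (Filter.Eventually.of_forall fun u _ => norm_bromwich_integrand_le_im hv u x)
    (Continuous.intervalIntegrable (by fun_prop) c l)
  refine h2.trans ?_
  rw [h1, div_div, ← neg_div_neg_eq, ← neg_mul]
  have : 0 < -x := by linarith
  gcongr
  linarith [Real.exp_pos (l * x)]

/-- The integrand has no pole in `Re s ≥ c`, so Cauchy's theorem moves the segment to `Re s = l` at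
the price of two horizontal sides. With `r` fixed, the moved segment contributes nothing as `l → ∞`.
-/
lemma norm_bromwichKernel_le_of_neg {c x r : ℝ} (hc : 0 < c) (hx : x < 0) (hr : 0 < r) :
    ‖bromwichKernel c x r‖ ≤ 2 * Real.exp (c * x) / (-x * r) := by
  have key : ∀ l, c ≤ l → ‖bromwichKernel c x r‖ ≤
      2 * Real.exp (c * x) / (-x * r) + Real.exp (l * x) / c * (2 * r) := by
    intro l hl
    have hl0 : 0 < l := hc.trans_le hl
    have hrect := Complex.integral_boundary_rect_eq_zero_of_differentiableOn
      (fun s : ℂ => Complex.exp (s * x) / s) ⟨c, -r⟩ ⟨l, r⟩ (by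
        intro s hs
        have hs0 : s ≠ 0 := by
          rintro rfl
          have := hs.1
          simp only [Set.uIcc_of_le hl, Set.mem_preimage, Set.mem_Icc, Complex.zero_re] at this
          linarith
        exact DifferentiableAt.differentiableWithinAt (by fun_prop (disch := exact hs0)))
    simp only [smul_eq_mul] at hrect
    have h1 := norm_integral_horizontal_le hl (neg_ne_zero.mpr hr.ne') hx
    have h2 := norm_integral_horizontal_le hl hr.ne' hx
    have h3 : ‖bromwichKernel l x r‖ ≤ Real.exp (l * x) / c * (2 * r) := by
      have := intervalIntegral.norm_integral_le_of_norm_le_const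
        (fun y (_ : y ∈ Set.uIoc (-r) r) => norm_bromwich_integrand_le_re hl0 x y)
      refine this.trans ?_
      rw [abs_of_pos (by linarith)]
      have : r - -r = 2 * r := by ring
      rw [this]
      gcongr
    rw [abs_neg, abs_of_pos hr] at h1
    rw [abs_of_pos hr] at h2
    have h4 : Complex.I * bromwichKernel c x r =
      (∫ u in c..l, Complex.exp (((u : ℝ) + ((-r : ℝ) : ℂ) * Complex.I) * x) /
        (u + ((-r : ℝ) : ℂ) * Complex.I))
      - (∫ u in c..l, Complex.exp (((u : ℝ) + r * Complex.I) * x) / (u + r * Complex.I))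
      + Complex.I * bromwichKernel l x r := by
      unfold bromwichKernel
      linear_combination -hrect
    calc ‖bromwichKernel c x r‖ = ‖Complex.I * bromwichKernel c x r‖ := by simp
      _ ≤ _ := by
        rw [h4]
        refine (norm_add_le _ _).trans ?_
        have := norm_sub_le (∫ u in c..l, Complex.exp (((u : ℝ) + ((-r : ℝ) : ℂ) * Complex.I) * x) /
          (u + ((-r : ℝ) : ℂ) * Complex.I))
          (∫ u in c..l, Complex.exp (((u : ℝ) + r * Complex.I) * x) / (u + r * Complex.I))
        rw [norm_mul, Complex.norm_I, one_mul]
        have h5 : 2 * Real.exp (c * x) / (-x * r)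
            = Real.exp (c * x) / (-x * r) + Real.exp (c * x) / (-x * r) := by ring
        rw [h5]
        linarith
  have hlim : Tendsto (fun l : ℝ => 2 * Real.exp (c * x) / (-x * r) + Real.exp (l * x) / c * (2 * r))
      atTop (𝓝 (2 * Real.exp (c * x) / (-x * r) + 0 / c * (2 * r))) := by
    refine tendsto_const_nhds.add (Tendsto.mul_const _ (Tendsto.div_const ?_ _))
    exact Real.tendsto_exp_atBot.comp (tendsto_id.atTop_mul_const_of_neg hx)
  have := ge_of_tendsto hlim (eventually_atTop.2 ⟨c, key⟩)
  simpa using this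

/-- Averaging the integral with its reflection under `y ↦ -y` leaves the real integrand `c / (c² +
y²)`. -/
lemma bromwichKernel_zero {c r : ℝ} (hc : 0 < c) :
    bromwichKernel c 0 r = ((2 * Real.arctan (r / c) : ℝ) : ℂ) := by
  have h1 : bromwichKernel c 0 r = ∫ y in (-r)..r, 1 / (c - y * Complex.I : ℂ) := by
    have := intervalIntegral.integral_comp_neg (a := -r) (b := r)
      (fun y : ℝ => 1 / (c + y * Complex.I : ℂ))
    rw [neg_neg] at this
    simp only [bromwichKernel, Complex.ofReal_zero, mul_zero, Complex.exp_zero]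
    rw [← this]
    congr 1; ext y; push_cast; ring_nf
  have h2 : bromwichKernel c 0 r = ∫ y in (-r)..r, 1 / (c + y * Complex.I : ℂ) := by
    simp [bromwichKernel]
  have h0 : ∀ y : ℝ, (c - y * Complex.I : ℂ) ≠ 0 := fun y => by
    simpa [sub_eq_add_neg] using line_ne_zero hc.ne' (-y)
  have h3 : bromwichKernel c 0 r + bromwichKernel c 0 r
      = ∫ y in (-r)..r, ((2 * c⁻¹ * (1 + (y / c) ^ 2)⁻¹ : ℝ) : ℂ) := by
    nth_rewrite 1 [h1]
    rw [h2, ← intervalIntegral.integral_add]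
    · congr 1
      ext y
      have ha := line_ne_zero hc.ne' y
      have hb := h0 y
      have hd : (1 + (y / c) ^ 2 : ℂ) = (c + y * Complex.I) * (c - y * Complex.I) / c ^ 2 := by
        have : (c : ℂ) ≠ 0 := by exact_mod_cast hc.ne'
        field_simp
        linear_combination (y : ℂ) ^ 2 * Complex.I_sq
      push_cast
      rw [hd]
      have : (c : ℂ) ≠ 0 := by exact_mod_cast hc.ne'
      field_simp
      ring
    · exact (Continuous.div (by fun_prop) (by fun_prop) h0).intervalIntegrable _ _
    · exact (Continuous.div (by fun_prop) (by fun_prop)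
        (line_ne_zero hc.ne')).intervalIntegrable _ _
  have h4 : ∫ y in (-r)..r, (2 * c⁻¹ * (1 + (y / c) ^ 2)⁻¹ : ℝ) = 4 * Real.arctan (r / c) := by
    rw [intervalIntegral.integral_const_mul,
      intervalIntegral.integral_comp_div (fun y => (1 + y ^ 2)⁻¹) hc.ne', integral_inv_one_add_sq,
      neg_div, Real.arctan_neg, smul_eq_mul]
    field_simp
    ring
  rw [intervalIntegral.integral_ofReal, h4] at h3
  have : bromwichKernel c 0 r = (bromwichKernel c 0 r + bromwichKernel c 0 r) / 2 := by ring
  rw [this, h3]; push_cast; ring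

lemma norm_bromwichKernel_zero_le {c r : ℝ} (hc : 0 < c) : ‖bromwichKernel c 0 r‖ ≤ Real.pi := by
  rw [bromwichKernel_zero hc, Complex.norm_real, Real.norm_eq_abs, abs_le]
  constructor <;>
  linarith [Real.arctan_lt_pi_div_two (r / c), Real.neg_pi_div_two_lt_arctan (r / c)]

/-- A substitute for the residue at `0`: the function `(exp (sx) - 1) / s` is entire, so its
integral around the rectangle with vertical sides `Re s = ±c` vanishes. The difference of the
vertical sides is the combination of kernels on the left, and the horizontal sides are `O(1/r)`. -/
lemma norm_bromwichKernel_add_neg_sub_le {c x r : ℝ} (hc : 0 < c) (hx : 0 < x) (hr : 0 < r) :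
    ‖bromwichKernel c x r + bromwichKernel c (-x) r - 2 * bromwichKernel c 0 r‖
      ≤ 8 * c * Real.exp (c * x) / r := by
  -- `dslope` fills in the removable singularity at `0`.
  set f : ℂ → ℂ := dslope (fun s : ℂ => Complex.exp (s * x)) 0 with hf
  have hdiff : Differentiable ℂ f := by
    rw [← differentiableOn_univ]
    refine (Complex.differentiableOn_dslope univ_mem).2 ?_
    rw [differentiableOn_univ]
    fun_prop
  have hval : ∀ s : ℂ, s ≠ 0 → f s = (Complex.exp (s * x) - 1) / s := by
    intro s hs
    rw [hf, dslope_of_ne _ hs, slope_def_field]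
    simp
  have hrect := Complex.integral_boundary_rect_eq_zero_of_differentiableOn f ⟨-c, -r⟩ ⟨c, r⟩
    hdiff.differentiableOn
  simp only [smul_eq_mul] at hrect
  have hi : ∀ z : ℝ, IntervalIntegrable (fun y : ℝ => Complex.exp ((c + y * Complex.I) * z) /
      (c + y * Complex.I)) volume (-r) r := fun z =>
    (continuous_bromwich_integrand hc.ne' z).intervalIntegrable _ _
  have hv1 : ∫ y in (-r)..r, f ((c : ℝ) + (y : ℝ) * Complex.I)
      = bromwichKernel c x r - bromwichKernel c 0 r := by
    unfold bromwichKernel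
    rw [← intervalIntegral.integral_sub (hi x) (hi 0)]
    congr 1; ext y
    rw [hval _ (line_ne_zero hc.ne' y)]
    simp [sub_div]
  have hv2 : ∫ y in (-r)..r, f (((-c : ℝ) : ℂ) + (y : ℝ) * Complex.I)
      = bromwichKernel c 0 r - bromwichKernel c (-x) r := by
    -- Reflecting `y` turns `-c + iy` into `-(c + iy)`, and `f (-s) = (1 - exp (-sx)) / s`.
    have := intervalIntegral.integral_comp_neg (a := -r) (b := r)
      (fun y : ℝ => f (((-c : ℝ) : ℂ) + (y : ℝ) * Complex.I))
    rw [neg_neg] at this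
    rw [← this]
    unfold bromwichKernel
    rw [← intervalIntegral.integral_sub (hi 0) (hi (-x))]
    congr 1; ext y
    have h0 := line_ne_zero hc.ne' y
    have h1 : (((-c : ℝ) : ℂ) + ((-y : ℝ) : ℂ) * Complex.I) = -(c + y * Complex.I) := by
      push_cast; ring
    rw [h1, hval _ (neg_ne_zero.mpr h0)]
    simp only [Complex.ofReal_zero, mul_zero, Complex.exp_zero, Complex.ofReal_neg, mul_neg,
      neg_mul]
    rw [← sub_div, div_neg, ← neg_div, neg_sub]
  have hh : ∀ v : ℝ, |v| = r →
      ‖∫ u in (-c)..c, f ((u : ℝ) + (v : ℝ) * Complex.I)‖ ≤ 4 * c * Real.exp (c * x) / r := by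
    intro v hv
    have hv0 : v ≠ 0 := by rintro rfl; simp at hv; linarith
    have := intervalIntegral.norm_integral_le_of_norm_le_const (a := -c) (b := c)
      (f := fun u : ℝ => f ((u : ℝ) + (v : ℝ) * Complex.I)) (C := 2 * Real.exp (c * x) / r) (by
        intro u hu
        rw [Set.uIoc_of_le (by linarith)] at hu
        have hs : (u + v * Complex.I : ℂ) ≠ 0 := fun h =>
          hv0 (by simpa using congrArg Complex.im h)
        have him : r ≤ ‖(u + v * Complex.I : ℂ)‖ := by
          simpa [hv] using Complex.abs_im_le_norm (u + v * Complex.I : ℂ)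
        rw [hval _ hs, norm_div]
        have hn : ‖Complex.exp ((u + v * Complex.I) * x) - 1‖ ≤ 2 * Real.exp (c * x) := by
          refine (norm_sub_le _ _).trans ?_
          rw [norm_exp_mul_ofReal, norm_one]
          have e1 : Real.exp ((u + v * Complex.I : ℂ).re * x) ≤ Real.exp (c * x) := by
            simp only [Complex.add_re, Complex.ofReal_re, Complex.mul_re, Complex.I_re, mul_zero,
              Complex.ofReal_im, Complex.I_im, mul_one, sub_self, add_zero]
            gcongr
            exact hu.2
          have e2 : 1 ≤ Real.exp (c * x) := Real.one_le_exp (by positivity)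
          linarith
        gcongr)
    refine this.trans (le_of_eq ?_)
    rw [abs_of_pos (by linarith)]
    ring
  have hb := hh (-r) (by rw [abs_neg, abs_of_pos hr])
  have ht := hh r (abs_of_pos hr)
  rw [hv1, hv2] at hrect
  have hmain : Complex.I * (bromwichKernel c x r + bromwichKernel c (-x) r
      - 2 * bromwichKernel c 0 r) = (∫ u in (-c)..c, f ((u : ℝ) + (r : ℝ) * Complex.I))
        - ∫ u in (-c)..c, f ((u : ℝ) + ((-r : ℝ) : ℂ) * Complex.I) := by
    linear_combination hrect
  calc _ = ‖Complex.I * (bromwichKernel c x r + bromwichKernel c (-x) r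
      - 2 * bromwichKernel c 0 r)‖ := by simp
    _ ≤ _ := by
      rw [hmain]
      refine (norm_sub_le _ _).trans ?_
      have : 8 * c * Real.exp (c * x) / r
        = 4 * c * Real.exp (c * x) / r + 4 * c * Real.exp (c * x) / r := by ring
      linarith

/-- Covers the range where the contour bound `1 / (|x| r)` is useless. After factoring out `exp
(cx)` and subtracting the kernel at `0`, the estimate `|exp (iyx) - 1| ≤ |y||x|` cancels the
denominator, and the remainder is at most `2r|x| ≤ 2`. -/
lemma norm_bromwichKernel_le_of_small {c x r : ℝ} (hc : 0 < c) (hr : 0 < r) (hx : |x| * r ≤ 1) :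
    ‖bromwichKernel c x r‖ ≤ (Real.pi + 2) * Real.exp (c * x) := by
  have h1 : bromwichKernel c x r = Complex.exp (c * x) * (bromwichKernel c 0 r +
      ∫ y in (-r)..r, (Complex.exp (Complex.I * ((y * x : ℝ) : ℂ)) - 1) / (c + y * Complex.I)) := by
    unfold bromwichKernel
    rw [← intervalIntegral.integral_add, ← intervalIntegral.integral_const_mul]
    · congr 1; ext y
      rw [← add_div, ← mul_div_assoc]
      congr 1
      simp only [Complex.ofReal_zero, mul_zero, Complex.exp_zero, add_sub_cancel]
      rw [← Complex.exp_add]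
      congr 1; push_cast; ring
    · exact (continuous_bromwich_integrand hc.ne' 0).intervalIntegrable _ _
    · exact (Continuous.div (by fun_prop) (by fun_prop)
        (line_ne_zero hc.ne')).intervalIntegrable _ _
  have h2 := intervalIntegral.norm_integral_le_of_norm_le_const (a := -r) (b := r) (C := |x|)
    (f := fun y : ℝ => (Complex.exp (Complex.I * ((y * x : ℝ) : ℂ)) - 1) / (c + y * Complex.I)) (by
      intro y _
      have e1 := Real.norm_exp_I_mul_ofReal_sub_one_le (x := y * x)
      have e2 : |y| ≤ ‖(c + y * Complex.I : ℂ)‖ := by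
        simpa using Complex.abs_im_le_norm (c + y * Complex.I : ℂ)
      rw [norm_div, div_le_iff₀ (norm_pos_iff.mpr (line_ne_zero hc.ne' y))]
      rw [Real.norm_eq_abs, abs_mul] at e1
      calc _ ≤ |y| * |x| := e1
        _ ≤ |x| * ‖(c + y * Complex.I : ℂ)‖ := by rw [mul_comm]; gcongr)
  have h3 : |r - -r| = 2 * r := by rw [abs_of_pos (by linarith)]; ring
  rw [h3] at h2
  have h4 := norm_bromwichKernel_zero_le (r := r) hc
  rw [h1, norm_mul, norm_exp_mul_ofReal, Complex.ofReal_re, mul_comm]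
  gcongr
  refine (norm_add_le _ _).trans ?_
  linarith

/-- The dominating function for the limit `r → ∞`. For `|x| r > 1`, negative `x` is handled by the
contour bound and positive `x` by reduction to `-x` and `0`. The terms `2π` and `8c` of the constant
come from the kernel at `0` and from the rectangle, with `r ≥ 1`; the `4` leaves slack. -/
lemma norm_bromwichKernel_le {c r : ℝ} (hc : 0 < c) (hr : 1 ≤ r) (x : ℝ) :
    ‖bromwichKernel c x r‖ ≤ (4 + 2 * Real.pi + 8 * c) * Real.exp (c * x) := by
  have hr0 : 0 < r := by linarith
  have hpi := Real.pi_pos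
  have hE := Real.exp_pos (c * x)
  have hneg : ∀ z, z < 0 → 1 < |z| * r → ‖bromwichKernel c z r‖ ≤ 2 * Real.exp (c * z) := by
    intro z hz hzr
    refine (norm_bromwichKernel_le_of_neg hc hz hr0).trans ?_
    rw [abs_of_neg hz] at hzr
    exact div_le_self (by positivity) hzr.le
  rcases le_or_gt (|x| * r) 1 with h | h
  · refine (norm_bromwichKernel_le_of_small hc hr0 h).trans ?_
    exact mul_le_mul_of_nonneg_right (by linarith) hE.le
  rcases lt_trichotomy x 0 with hx | hx | hx
  · refine (hneg x hx h).trans ?_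
    gcongr
    linarith
  · simp [hx] at h; linarith
  · have h1 := norm_bromwichKernel_add_neg_sub_le hc hx hr0
    have h2 := hneg (-x) (by linarith) (by rwa [abs_neg])
    have h3 := norm_bromwichKernel_zero_le (r := r) hc
    have h4 : Real.exp (c * -x) ≤ Real.exp (c * x) := by
      apply Real.exp_le_exp.mpr; nlinarith
    have h5 : 1 ≤ Real.exp (c * x) := Real.one_le_exp (by positivity)
    have h6 : 8 * c * Real.exp (c * x) / r ≤ 8 * c * Real.exp (c * x) :=
      div_le_self (by positivity) hr
    have h7 : bromwichKernel c x r = (bromwichKernel c x r + bromwichKernel c (-x) r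
      - 2 * bromwichKernel c 0 r) - bromwichKernel c (-x) r + 2 * bromwichKernel c 0 r := by ring
    rw [h7]
    refine (norm_add_le _ _).trans ?_
    have h8 := norm_sub_le (bromwichKernel c x r + bromwichKernel c (-x) r
      - 2 * bromwichKernel c 0 r) (bromwichKernel c (-x) r)
    rw [norm_mul, Complex.norm_ofNat]
    nlinarith

lemma tendsto_bromwichKernel_of_neg {c x : ℝ} (hc : 0 < c) (hx : x < 0) :
    Tendsto (bromwichKernel c x) atTop (𝓝 0) := by
  refine squeeze_zero_norm' (a := fun r => 2 * Real.exp (c * x) / (-x * r)) ?_ ?_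
  · filter_upwards [eventually_gt_atTop 0] with r hr using norm_bromwichKernel_le_of_neg hc hx hr
  · exact tendsto_const_nhds.div_atTop (tendsto_id.const_mul_atTop (by linarith))

lemma tendsto_bromwichKernel_of_pos {c x : ℝ} (hc : 0 < c) (hx : 0 < x) :
    Tendsto (bromwichKernel c x) atTop (𝓝 ((2 * Real.pi : ℝ) : ℂ)) := by
  have h1 : Tendsto (fun r => bromwichKernel c x r + bromwichKernel c (-x) r
      - 2 * bromwichKernel c 0 r) atTop (𝓝 0) := by
    refine squeeze_zero_norm' (a := fun r => 8 * c * Real.exp (c * x) / r) ?_ ?_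
    · filter_upwards [eventually_gt_atTop 0] with r hr using
        norm_bromwichKernel_add_neg_sub_le hc hx hr
    · exact tendsto_const_nhds.div_atTop tendsto_id
  have h2 := tendsto_bromwichKernel_of_neg hc (neg_lt_zero.mpr hx)
  have h3 : Tendsto (fun r => bromwichKernel c 0 r) atTop (𝓝 ((2 * (Real.pi / 2) : ℝ) : ℂ)) := by
    simp only [bromwichKernel_zero hc]
    refine (Complex.continuous_ofReal.tendsto _).comp (Tendsto.const_mul _ ?_)
    exact (Real.tendsto_arctan_atTop.mono_right nhdsWithin_le_nhds).comp
      (tendsto_id.atTop_div_const hc)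
  have := (h1.sub h2).add (h3.const_mul 2)
  refine (this.congr fun r => ?_).trans (le_of_eq ?_)
  · ring
  · congr 1; push_cast; ring

/-- Bromwich inversion at `0` of a bilateral Laplace transform divided by `s`: it recovers the
mass of the positive half-line, when there is no mass at `0`. -/
theorem hasInverseLaplaceAt_zero {Ω : Type*} [MeasurableSpace Ω] (μ : Measure Ω)
    [IsFiniteMeasure μ] {Y : Ω → ℝ} (hY : Measurable Y) (hY0 : ∀ᵐ ω ∂μ, Y ω ≠ 0) {c : ℝ}
    (hc : 0 < c) (hint : Integrable (fun ω => Real.exp (c * Y ω)) μ) {F : ℂ → ℂ}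
    (hF : ∀ s : ℂ, s.re = c → F s = 1 / s * ∫ ω, Complex.exp (s * Y ω) ∂μ) :
    HasInverseLaplaceAt F c 0 (μ.real {ω | 0 < Y ω} : ℝ) := by
  have hF' : (fun y : ℝ => Complex.exp ((c + y * Complex.I) * (0 : ℝ)) * F (c + y * Complex.I))
      = fun y : ℝ => ∫ ω, Complex.exp ((c + y * Complex.I) * Y ω) / (c + y * Complex.I) ∂μ := by
    ext y
    rw [hF _ (by simp), integral_div]
    simp [div_eq_inv_mul]
  -- On the line `|1/s| ≤ 1/c`, so `exp (cY) / c` dominates on the bounded range of `y`. This gives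
  -- both Fubini and the existence of the truncated integrals.
  have hprod : ∀ r : ℝ, Integrable (Function.uncurry fun (y : ℝ) (ω : Ω) =>
      Complex.exp ((c + y * Complex.I) * Y ω) / (c + y * Complex.I))
      ((volume.restrict (Set.uIoc (-r) r)).prod μ) := by
    intro r
    have : IsFiniteMeasure (volume.restrict (Set.uIoc (-r) r)) := ⟨by simp [Set.uIoc]⟩
    have hb : Integrable (fun z : ℝ × Ω => (1 / c : ℝ) * Real.exp (c * Y z.2))
        ((volume.restrict (Set.uIoc (-r) r)).prod μ) :=
      Integrable.mul_prod (f := fun _ : ℝ => (1 / c : ℝ)) (integrable_const _) hint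
    refine hb.mono' ?_ (Filter.Eventually.of_forall fun z => ?_)
    · refine Measurable.aestronglyMeasurable ?_
      simp only [Function.uncurry_def]
      fun_prop
    · refine (norm_bromwich_integrand_le_re hc (Y z.2) z.1).trans (le_of_eq ?_)
      ring
  refine ⟨fun r => ?_, ?_⟩
  · rw [hF', intervalIntegrable_iff]
    exact (hprod r).integral_prod_left
  rw [hF']
  have hswap : ∀ r : ℝ, ∫ y in (-r)..r, ∫ ω, Complex.exp ((c + y * Complex.I) * Y ω) /
      (c + y * Complex.I) ∂μ = ∫ ω, bromwichKernel c (Y ω) r ∂μ := fun r =>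
    intervalIntegral_integral_swap (hprod r)
  simp only [hswap]
  have hlim : Tendsto (fun r => ∫ ω, bromwichKernel c (Y ω) r ∂μ) atTop
      (𝓝 (∫ ω, {ω | 0 < Y ω}.indicator (fun _ => ((2 * Real.pi : ℝ) : ℂ)) ω ∂μ)) := by
    refine tendsto_integral_filter_of_dominated_convergence
      (fun ω => (4 + 2 * Real.pi + 8 * c) * Real.exp (c * Y ω)) ?_ ?_ (hint.const_mul _) ?_
    · filter_upwards [eventually_ge_atTop 0] with r hr
      have := (hprod r).integral_prod_right.aestronglyMeasurable
      simp only [bromwichKernel, intervalIntegral.integral_of_le (by linarith : -r ≤ r)]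
      simpa [Set.uIoc_of_le (by linarith : -r ≤ r)] using this
    · filter_upwards [eventually_ge_atTop 1] with r hr
      exact Filter.Eventually.of_forall fun ω => norm_bromwichKernel_le hc hr (Y ω)
    · filter_upwards [hY0] with ω hω
      rcases lt_or_gt_of_ne hω with h | h
      · rw [Set.indicator_of_notMem (by simpa using h.le)]
        exact tendsto_bromwichKernel_of_neg hc h
      · rw [Set.indicator_of_mem (by simpa using h)]
        exact tendsto_bromwichKernel_of_pos hc h
  have hms : MeasurableSet {ω | 0 < Y ω} := measurableSet_lt measurable_const hY
  rw [integral_indicator_const _ hms] at hlim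
  refine (hlim.const_mul (1 / (2 * Real.pi) : ℂ)).trans (le_of_eq ?_)
  congr 1
  have : (Real.pi : ℂ) ≠ 0 := by exact_mod_cast Real.pi_ne_zero
  rw [Complex.real_smul]
  push_cast
  field_simp

section RandomTimes

/-! ### First times -/

lemma firstTime_lt_iff {A : ℝ≥0 → Prop} {x : ℝ≥0∞} :
    firstTime A < x ↔ ∃ t : ℝ≥0, A t ∧ (t : ℝ≥0∞) < x := by
  simp [firstTime, iInf_lt_iff]

lemma firstTime_le {A : ℝ≥0 → Prop} {t : ℝ≥0} (h : A t) : firstTime A ≤ t :=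
  iInf₂_le t h

lemma not_of_lt_firstTime {A : ℝ≥0 → Prop} {t : ℝ≥0} (h : (t : ℝ≥0∞) < firstTime A) : ¬ A t :=
  fun hA => (firstTime_le hA).not_gt h

/-- If `A` fails up to time `t` and its failure is right-open, then it first holds after `t`. -/
lemma lt_firstTime {A : ℝ≥0 → Prop} {t : ℝ≥0} (ht : ∀ᶠ u in 𝓝[>] t, ¬ A u)
    (h : ∀ u ≤ t, ¬ A u) : (t : ℝ≥0∞) < firstTime A := by
  obtain ⟨v, hv, hA⟩ := (mem_nhdsGT_iff_exists_Ioo_subset).1 ht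
  have hv' : t < v := hv
  refine (ENNReal.coe_lt_coe.2 hv').trans_le (le_iInf₂ fun u hu => ?_)
  by_contra hlt
  have huv : u < v := by simpa using hlt
  rcases le_or_gt u t with h1 | h1
  · exact h u h1 hu
  · exact hA ⟨h1, huv⟩ hu

/-- Right-continuity makes the infimum a minimum: if `A` failed at `t`, it would also fail just
after `t`, and the infimum would be larger. -/
lemma firstTime_attained {A : ℝ≥0 → Prop} {t : ℝ≥0} (hA : ¬ A t → ∀ᶠ u in 𝓝[>] t, ¬ A u)
    (h : firstTime A = t) : A t := by
  by_contra hn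
  have := lt_firstTime (hA hn) (fun u hu => by
    rcases hu.lt_or_eq with h1 | rfl
    · exact not_of_lt_firstTime (by rw [h]; exact_mod_cast h1)
    · exact hn)
  rw [h] at this
  exact lt_irrefl _ this

variable {Ω : Type*}

/-- A path that is at `0` stays there for a while, so a countable dense set of times detects the
passage. The σ-algebra is left free so that the lemma also applies to the one generated by `Z`
alone, as independence requires. -/
lemma measurable_passageTime {mΩ : MeasurableSpace Ω} {Z : ℝ≥0 → Ω → ℕ}
    (hZ : ∀ t, Measurable (Z t)) (hr : ∀ ω t, ∀ᶠ u in 𝓝[>] t, Z u ω = Z t ω) :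
    Measurable (passageTime Z) := by
  refine measurable_of_Iio fun x => ?_
  obtain ⟨s, hsc, hsd⟩ := TopologicalSpace.exists_countable_dense ℝ≥0
  have : passageTime Z ⁻¹' Set.Iio x
      = ⋃ t ∈ s ∩ {t : ℝ≥0 | (t : ℝ≥0∞) < x}, {ω | Z t ω = 0} := by
    ext ω
    simp only [Set.mem_preimage, Set.mem_Iio, passageTime, firstTime_lt_iff, Set.mem_iUnion,
      Set.mem_ofPred_eq, exists_prop, Set.mem_inter_iff]
    constructor
    · rintro ⟨t, ht, htx⟩
      have h1 : ∀ᶠ u : ℝ≥0 in 𝓝[>] t, (u : ℝ≥0∞) < x :=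
        (ENNReal.continuous_coe.continuousAt.eventually_lt_const htx).filter_mono
          nhdsWithin_le_nhds
      obtain ⟨v, hv, hA⟩ := (mem_nhdsGT_iff_exists_Ioo_subset).1 ((hr ω t).and h1)
      have hv' : t < v := hv
      obtain ⟨u, hus, hu⟩ := hsd.exists_between hv'
      obtain ⟨h2, h3⟩ := hA hu
      exact ⟨u, ⟨hus, h3⟩, by rw [h2, ht]⟩
    · rintro ⟨t, ⟨_, htx⟩, ht⟩
      exact ⟨t, ht, htx⟩
  rw [this]
  refine MeasurableSet.biUnion (hsc.mono Set.inter_subset_left) fun t _ => ?_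
  exact hZ t (measurableSet_singleton 0)

variable [MeasurableSpace Ω]

/-! ### Absence of atoms -/

/-- A finite derivative at `0` forces continuity at `0`. -/
lemma IsTransitionFunction.tendsto_off_diagonal {p : ℝ≥0 → ℕ → ℕ → ℝ} {q : ℕ → ℕ → ℝ}
    (hp : IsTransitionFunction p q) {x y : ℕ} (hxy : x ≠ y) :
    Tendsto (fun h => p h x y) (𝓝[>] 0) (𝓝 0) := by
  have h1 := hp.deriv_zero x y
  have h2 : Tendsto (fun h : ℝ≥0 => (h : ℝ)) (𝓝[>] 0) (𝓝 0) :=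
    (NNReal.continuous_coe.tendsto' 0 0 rfl).mono_left nhdsWithin_le_nhds
  have h3 := h1.mul h2
  rw [mul_zero] at h3
  refine h3.congr' ?_
  filter_upwards [self_mem_nhdsWithin] with h hh
  have : (h : ℝ) ≠ 0 := by exact_mod_cast (show (0 : ℝ≥0) < h from hh).ne'
  rw [hp.zero, if_neg hxy, sub_zero, div_mul_cancel₀ _ this]

/-- A Markov jump process does not jump from `x` to `y` at a deterministic time. -/
lemma IsMarkovJumpProcess.measure_left_limit_eq {P : Measure Ω} [IsProbabilityMeasure P]
    {Z : ℝ≥0 → Ω → ℕ} {x₀ : ℕ} {q : ℕ → ℕ → ℝ} (hZ : IsMarkovJumpProcess P Z x₀ q) {t : ℝ≥0}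
    (ht : 0 < t) {x y : ℕ} (hxy : x ≠ y) :
    P {ω | (∀ᶠ u in 𝓝[<] t, Z u ω = x) ∧ Z t ω = y} = 0 := by
  obtain ⟨p, hp, hmk⟩ := hZ.markov
  -- The shift by `2` keeps `h k < t` already for `k = 0`.
  let h : ℕ → ℝ≥0 := fun k => t / (k + 2)
  have hpos : ∀ k, 0 < h k := fun k => by positivity
  have hlt : ∀ k, h k < t := fun k => by
    refine div_lt_self ht ?_
    exact_mod_cast (by omega : 1 < k + 2)
  have hlim0 : Tendsto h atTop (𝓝 0) := by
    rw [← NNReal.tendsto_coe]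
    simp only [h, NNReal.coe_div, NNReal.coe_add, NNReal.coe_natCast, NNReal.coe_ofNat]
    exact tendsto_const_nhds.div_atTop
      (tendsto_atTop_add_const_right _ _ tendsto_natCast_atTop_atTop)
  have hlim : Tendsto h atTop (𝓝[>] 0) :=
    tendsto_nhdsWithin_iff.2 ⟨hlim0, Filter.Eventually.of_forall hpos⟩
  have hlimt : Tendsto (fun k => t - h k) atTop (𝓝[<] t) := by
    refine tendsto_nhdsWithin_iff.2 ⟨?_, Filter.Eventually.of_forall fun k => ?_⟩
    · simpa using (tendsto_const_nhds (x := t)).sub hlim0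
    · exact tsub_lt_self ht (hpos k)
  -- On the event, `Z (t - h k) = x` for all large `k`. Each set of the union thus has probability
  -- at most `p (h k) x y` for every `k ≥ K`, which tends to `0`.
  have hsub : {ω | (∀ᶠ u in 𝓝[<] t, Z u ω = x) ∧ Z t ω = y}
      ⊆ ⋃ K : ℕ, {ω | ∀ k ≥ K, Z (t - h k) ω = x ∧ Z t ω = y} := by
    rintro ω ⟨h1, h2⟩
    obtain ⟨K, hK⟩ := eventually_atTop.1 (hlimt.eventually h1)
    exact Set.mem_iUnion.2 ⟨K, fun k hk => ⟨hK k hk, h2⟩⟩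
  refine measure_mono_null hsub (measure_iUnion_null fun K => ?_)
  rw [← measureReal_eq_zero_iff]
  refine le_antisymm ?_ measureReal_nonneg
  refine ge_of_tendsto ((hp.tendsto_off_diagonal hxy).comp hlim) (eventually_atTop.2 ⟨K, ?_⟩)
  intro k hk
  have h1 := hmk (t - h k) (h k) x y Set.univ MeasurableSet.univ
  rw [tsub_add_cancel_of_le (hlt k).le] at h1
  calc P.real {ω | ∀ k ≥ K, Z (t - h k) ω = x ∧ Z t ω = y}
      ≤ P.real (Set.univ ∩ {ω | Z (t - h k) ω = x} ∩ {ω | Z t ω = y}) :=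
        measureReal_mono fun ω hω => ⟨⟨trivial, (hω k hk).1⟩, (hω k hk).2⟩
    _ = P.real (Set.univ ∩ {ω | Z (t - h k) ω = x}) * p (h k) x y := h1
    _ ≤ 1 * p (h k) x y := by
        gcongr
        · exact hp.nonneg _ _ _
        · exact measureReal_le_one
    _ = _ := one_mul _

/-- A first passage at `t > 0` is a jump into `0` at time `t` from a nonzero left limit. There are
countably many such limits, each of probability zero. Passage at time `0` is excluded by the
starting point. -/
lemma IsMarkovJumpProcess.measure_passageTime_eq {P : Measure Ω} [IsProbabilityMeasure P]
    {Z : ℝ≥0 → Ω → ℕ} {x₀ : ℕ} {q : ℕ → ℕ → ℝ} (hZ : IsMarkovJumpProcess P Z x₀ q)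
    (hx₀ : x₀ ≠ 0) (t : ℝ≥0) : P {ω | passageTime Z ω = t} = 0 := by
  have hatt : ∀ ω, passageTime Z ω = t → Z t ω = 0 := fun ω h =>
    firstTime_attained (fun hn => (hZ.right_continuous ω t).mono fun u hu => by rwa [hu]) h
  rcases eq_zero_or_pos t with rfl | ht
  · have := hZ.start
    rw [ae_iff] at this
    refine measure_mono_null (fun ω h => ?_) this
    change ¬ _
    rw [hatt ω h]
    exact hx₀.symm
  · have hsub : {ω | passageTime Z ω = t}
        ⊆ ⋃ x : {x : ℕ // x ≠ 0}, {ω | (∀ᶠ u in 𝓝[<] t, Z u ω = x) ∧ Z t ω = 0} := by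
      intro ω h
      obtain ⟨x, hx⟩ := hZ.left_limit ω t ht
      have hne : (𝓝[<] t).NeBot := nhdsLT_neBot_of_exists_lt ⟨0, ht⟩
      obtain ⟨u, hu, hut⟩ := (hx.and self_mem_nhdsWithin).exists
      have hx0 : x ≠ 0 := by
        rintro rfl
        refine not_of_lt_firstTime (A := fun t => Z t ω = 0) (t := u) ?_ hu
        have : firstTime (fun t => Z t ω = 0) = t := h
        rw [this]
        exact_mod_cast (show u < t from hut)
      exact Set.mem_iUnion.2 ⟨⟨x, hx0⟩, hx, hatt ω h⟩
    exact measure_mono_null hsub (measure_iUnion_null fun x => hZ.measure_left_limit_eq ht x.2)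

/-- An atom at `t > 0` is at most the drop of the tail over `[s, t]`, which vanishes as `s ↑ t`. An
atom at `0` is excluded because the tail at `0` is `1`. -/
lemma IsExponentialTime.measure_eq {P : Measure Ω} [IsProbabilityMeasure P] {T : Ω → ℝ≥0∞}
    {rate : ℝ≥0} (hT : IsExponentialTime P T rate) (t : ℝ≥0) : P {ω | T ω = t} = 0 := by
  have hms : ∀ s : ℝ≥0, MeasurableSet {ω | (s : ℝ≥0∞) < T ω} := fun s =>
    measurableSet_lt measurable_const hT.measurable
  rcases eq_zero_or_pos t with rfl | ht
  · have h0 := hT.tail 0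
    simp only [NNReal.coe_zero, mul_zero, neg_zero, Real.exp_zero] at h0
    have h1 := probReal_compl_eq_one_sub (μ := P) (hms 0)
    rw [h0, sub_self, measureReal_eq_zero_iff] at h1
    refine measure_mono_null (fun ω h => ?_) h1
    have h' : T ω = 0 := by simpa using h
    simp [h']
  rw [← measureReal_eq_zero_iff]
  refine le_antisymm ?_ measureReal_nonneg
  have hlim : Tendsto (fun s : ℝ≥0 => Real.exp (-(rate * s)) - Real.exp (-(rate * t))) (𝓝[<] t)
      (𝓝 (Real.exp (-(rate * t)) - Real.exp (-(rate * t)))) :=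
    ((Continuous.tendsto (by fun_prop) t)).mono_left nhdsWithin_le_nhds
  rw [sub_self] at hlim
  have hne : (𝓝[<] t).NeBot := nhdsLT_neBot_of_exists_lt ⟨0, ht⟩
  refine ge_of_tendsto hlim ?_
  filter_upwards [self_mem_nhdsWithin] with s hs
  have hst : (s : ℝ≥0∞) < t := by exact_mod_cast (show s < t from hs)
  have hsub : {ω | (t : ℝ≥0∞) < T ω} ⊆ {ω | (s : ℝ≥0∞) < T ω} := fun ω h => hst.trans h
  rw [← hT.tail, ← hT.tail, ← measureReal_sdiff hsub (hms t)]
  refine measureReal_mono fun ω h => ?_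
  have h' : T ω = t := h
  simp [h', hst]

/-- Independent times do not coincide if one of them has no atoms. -/
lemma ae_ne_of_indepFun {P : Measure Ω} [IsProbabilityMeasure P] {S T : Ω → ℝ≥0∞}
    (hS : Measurable S) (hT : Measurable T) (hST : IndepFun S T P)
    (h : ∀ t : ℝ≥0, P {ω | S ω = t} = 0) : ∀ᵐ ω ∂P, S ω ≠ ∞ → S ω ≠ T ω := by
  have hmap := (indepFun_iff_map_prod_eq_prod_map_map hT.aemeasurable hS.aemeasurable).1 hST.symm
  have hset : MeasurableSet {z : ℝ≥0∞ × ℝ≥0∞ | z.2 ≠ ∞ ∧ z.2 = z.1} :=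
    ((measurableSet_singleton ∞).compl.preimage measurable_snd).inter
      (measurableSet_eq_fun measurable_snd measurable_fst)
  have h0 : (P.map T).prod (P.map S) {z : ℝ≥0∞ × ℝ≥0∞ | z.2 ≠ ∞ ∧ z.2 = z.1} = 0 := by
    rw [Measure.measure_prod_null hset]
    -- The section over a finite value `x` of `T` is an atom of `S`; over `x = ∞` it is empty, since
    -- only finite coincidences are counted.
    refine Filter.Eventually.of_forall fun x => ?_
    rcases eq_or_ne x ∞ with rfl | hx
    · simp only [Pi.zero_apply]
      convert measure_empty (μ := P.map S)
      ext z
      simp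
    · lift x to ℝ≥0 using hx
      simp only [Pi.zero_apply]
      rw [Measure.map_apply hS (measurable_prodMk_left hset)]
      refine measure_mono_null (fun ω hω => ?_) (h x)
      exact hω.2
  rw [← hmap, Measure.map_apply (hT.prodMk hS) hset] at h0
  rw [ae_iff]
  refine measure_mono_null (fun ω hω => ?_) h0
  simpa using hω

/-! ### Minima of independent times -/

lemma indepFun_finset_inf {ι : Type*} {P : Measure Ω} {Y : ι → Ω → ℝ≥0∞} (hY : iIndepFun Y P)
    (hm : ∀ d, Measurable (Y d)) {S : Finset ι} {d : ι} (hd : d ∉ S) :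
    IndepFun (Y d) (fun ω => S.inf fun e => Y e ω) P := by
  have h := hY.indepFun_finset {d} S (by simpa using hd) hm
  have h1 : Measurable fun v : (({d} : Finset ι) → ℝ≥0∞) => v ⟨d, by simp⟩ := measurable_pi_apply _
  have h2 : Measurable fun v : (S → ℝ≥0∞) => ⨅ e, v e := Measurable.iInf fun e => measurable_pi_apply e
  have := h.comp h1 h2
  have hinf : (fun ω => S.inf fun e => Y e ω)
      = (fun v : (S → ℝ≥0∞) => ⨅ e, v e) ∘ fun ω (e : S) => Y e ω := by
    ext ω
    simp [Finset.inf_eq_iInf, iInf_subtype]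
  rw [hinf]
  exact this

lemma measurable_finset_inf {ι : Type*} {Y : ι → Ω → ℝ≥0∞} (hm : ∀ d, Measurable (Y d))
    (S : Finset ι) : Measurable fun ω => S.inf fun e => Y e ω := by
  simp only [Finset.inf_eq_iInf, iInf_subtype']
  exact Measurable.iInf fun e => hm e

lemma measureReal_lt_finset_inf {ι : Type*} {P : Measure Ω} {Y : ι → Ω → ℝ≥0∞}
    (hY : iIndepFun Y P) (S : Finset ι) (t : ℝ≥0) :
    P.real {ω | (t : ℝ≥0∞) < S.inf fun e => Y e ω} = ∏ e ∈ S, P.real {ω | (t : ℝ≥0∞) < Y e ω} := by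
  have h := hY.measure_inter_preimage_eq_mul S (sets := fun _ => Set.Ioi (t : ℝ≥0∞))
    fun _ _ => measurableSet_Ioi
  simp only [measureReal_def]
  rw [← ENNReal.toReal_prod]
  have hset : {ω | (t : ℝ≥0∞) < S.inf fun e => Y e ω}
      = ⋂ e ∈ S, Y e ⁻¹' Set.Ioi (t : ℝ≥0∞) := by
    ext ω
    simp [Finset.lt_inf_iff]
  rw [hset, h]
  rfl

/-! ### Tails and Laplace transforms -/

lemma setIntegral_indicator_ofReal_lt {E : Type*} [NormedAddCommGroup E] [NormedSpace ℝ E]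
    (f : ℝ → E) {y : ℝ≥0∞} (hy : y ≠ ∞) :
    ∫ t in Set.Ioi (0 : ℝ), {t | ENNReal.ofReal t < y}.indicator f t
      = ∫ t in (0 : ℝ)..y.toReal, f t := by
  rw [setIntegral_indicator (measurableSet_lt ENNReal.measurable_ofReal measurable_const),
    intervalIntegral.integral_of_le ENNReal.toReal_nonneg, integral_Ioc_eq_integral_Ioo]
  congr 2
  ext t
  simp only [Set.mem_inter_iff, Set.mem_Ioi, Set.mem_ofPred_eq, Set.mem_Ioo]
  exact and_congr_right fun ht => ENNReal.ofReal_lt_iff_lt_toReal ht.le hy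

/-- This kernel carries the integration by parts: over `t > 0` it integrates to `(exp (zY) - 1) / z`
for finite `Y`, and over `ω` to `exp (zt) P(Y > t)`. -/
lemma measurable_tail_kernel {Y : Ω → ℝ≥0∞} (hY : Measurable Y) (z : ℂ) :
    Measurable fun w : Ω × ℝ =>
      {t | ENNReal.ofReal t < Y w.1}.indicator (fun t : ℝ => Complex.exp (z * t)) w.2 := by
  have : MeasurableSet {w : Ω × ℝ | ENNReal.ofReal w.2 < Y w.1} :=
    measurableSet_lt (by fun_prop) (by fun_prop)
  exact Measurable.indicator (f := fun w : Ω × ℝ => Complex.exp (z * w.2)) (by fun_prop) this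

lemma integral_norm_tail_kernel (P : Measure Ω) {Y : Ω → ℝ≥0∞} (hY : Measurable Y) (z : ℂ) (t : ℝ) :
    ∫ ω, ‖{t | ENNReal.ofReal t < Y ω}.indicator (fun t : ℝ => Complex.exp (z * t)) t‖ ∂P
      = Real.exp (z.re * t) * P.real {ω | ENNReal.ofReal t < Y ω} := by
  have hms : MeasurableSet {ω | ENNReal.ofReal t < Y ω} := measurableSet_lt measurable_const hY
  have : ∀ ω, ‖{t | ENNReal.ofReal t < Y ω}.indicator (fun t : ℝ => Complex.exp (z * t)) t‖
      = {ω | ENNReal.ofReal t < Y ω}.indicator (fun _ => Real.exp (z.re * t)) ω := by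
    intro ω
    rw [norm_indicator_eq_indicator_norm]
    simp [Set.indicator_apply, norm_exp_mul_ofReal]
  simp only [this]
  rw [integral_indicator_const _ hms, smul_eq_mul, mul_comm]

lemma integrable_tail_kernel {P : Measure Ω} [IsFiniteMeasure P] {Y : Ω → ℝ≥0∞} (hY : Measurable Y)
    {z : ℂ} (h : IntegrableOn
      (fun t : ℝ => Real.exp (z.re * t) * P.real {ω | ENNReal.ofReal t < Y ω}) (Set.Ioi 0)) :
    Integrable (Function.uncurry fun (ω : Ω) (t : ℝ) =>
      {t | ENNReal.ofReal t < Y ω}.indicator (fun t : ℝ => Complex.exp (z * t)) t)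
      (P.prod (volume.restrict (Set.Ioi 0))) := by
  have hm := measurable_tail_kernel hY z
  rw [integrable_prod_iff' (by exact hm.aestronglyMeasurable)]
  refine ⟨Filter.Eventually.of_forall fun t => ?_, ?_⟩
  · refine Integrable.of_bound (C := Real.exp (z.re * t)) ?_ (Filter.Eventually.of_forall fun ω => ?_)
    · exact (hm.comp (measurable_id.prodMk measurable_const)).aestronglyMeasurable
    · refine (norm_indicator_le_norm_self (fun t : ℝ => Complex.exp (z * t)) t).trans ?_
      rw [norm_exp_mul_ofReal]
  · simp only [Function.uncurry, integral_norm_tail_kernel P hY]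
    exact h

/-- Integration by parts between the tail of a random time and its Laplace transform. -/
lemma laplace_neg_sub_one_eq {P : Measure Ω} [IsProbabilityMeasure P] {Y : Ω → ℝ≥0∞}
    (hY : Measurable Y) {z : ℂ} (hz : z ≠ 0) (hcase : z.re < 0 ∨ ∀ᵐ ω ∂P, Y ω < ∞)
    (h : IntegrableOn
      (fun t : ℝ => Real.exp (z.re * t) * P.real {ω | ENNReal.ofReal t < Y ω}) (Set.Ioi 0)) :
    IntegrableOn (fun ω => Complex.exp (z * (Y ω).toReal)) {ω | Y ω < ∞} P ∧
    laplace P Y (-z) - 1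
      = z * ∫ t in Set.Ioi (0 : ℝ),
          Complex.exp (z * t) * P.real {ω | ENNReal.ofReal t < Y ω} := by
  have hk := integrable_tail_kernel hY h
  have hfin : MeasurableSet {ω | Y ω < ∞} := measurableSet_lt hY measurable_const
  have hsec : ∀ᵐ ω ∂P, ∫ t in Set.Ioi (0 : ℝ),
      {t | ENNReal.ofReal t < Y ω}.indicator (fun t : ℝ => Complex.exp (z * t)) t
      = ({ω | Y ω < ∞}.indicator (fun ω => Complex.exp (z * (Y ω).toReal)) ω - 1) / z := by
    have hfinite : ∀ ω, Y ω < ∞ → ∫ t in Set.Ioi (0 : ℝ),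
      {t | ENNReal.ofReal t < Y ω}.indicator (fun t : ℝ => Complex.exp (z * t)) t
      = ({ω | Y ω < ∞}.indicator (fun ω => Complex.exp (z * (Y ω).toReal)) ω - 1) / z := by
      intro ω hω
      rw [setIntegral_indicator_ofReal_lt _ hω.ne, integral_exp_mul_complex hz,
        Set.indicator_of_mem (by exact hω)]
      simp
    -- Where `Y = ∞` the integral is `-1/z`, matching the indicator value `0`, but it needs `Re z <
    -- 0`; otherwise `Y = ∞` must be null.
    rcases hcase with hre | hae
    · refine Filter.Eventually.of_forall fun ω => ?_
      rcases eq_or_ne (Y ω) ∞ with hω | hω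
      · rw [Set.indicator_of_notMem (by simp [hω])]
        have := integral_exp_mul_complex_Ioi hre 0
        simp only [hω, ENNReal.ofReal_lt_top, Set.ofPred_true, Set.indicator_univ]
        rw [this]
        simp
      · exact hfinite ω hω.lt_top
    · filter_upwards [hae] with ω hω using hfinite ω hω
  have hi1 := hk.integral_prod_left
  simp only [Function.uncurry] at hi1
  -- Integrability of the exponential is a by-product of Fubini, since the inner integral is an
  -- affine function of it.
  have hi2 : Integrable ({ω | Y ω < ∞}.indicator fun ω => Complex.exp (z * (Y ω).toReal)) P := by
    refine (((hi1.congr hsec).mul_const z).add (integrable_const (1 : ℂ))).congr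
      (Filter.Eventually.of_forall fun ω => ?_)
    simp only [Pi.add_apply]
    rw [div_mul_cancel₀ _ hz, sub_add_cancel]
  refine ⟨(integrable_indicator_iff hfin).1 hi2, ?_⟩
  have hswap := integral_integral_swap hk
  rw [integral_congr_ae hsec, integral_div, integral_sub hi2 (integrable_const _),
    integral_indicator hfin] at hswap
  have hlap : laplace P Y (-z) = ∫ ω in {ω | Y ω < ∞}, Complex.exp (z * (Y ω).toReal) ∂P := by
    simp [laplace]
  have hin : ∀ t : ℝ, ∫ ω, {t | ENNReal.ofReal t < Y ω}.indicator
      (fun t : ℝ => Complex.exp (z * t)) t ∂P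
      = Complex.exp (z * t) * P.real {ω | ENNReal.ofReal t < Y ω} := by
    intro t
    have hms : MeasurableSet {ω | ENNReal.ofReal t < Y ω} := measurableSet_lt measurable_const hY
    have : ∀ ω, {t | ENNReal.ofReal t < Y ω}.indicator (fun t : ℝ => Complex.exp (z * t)) t
        = {ω | ENNReal.ofReal t < Y ω}.indicator (fun _ => Complex.exp (z * t)) ω := fun ω => by
      simp [Set.indicator_apply]
    simp only [this]
    rw [integral_indicator_const _ hms, Complex.real_smul, mul_comm]
  simp only [hin] at hswap
  rw [← hswap, hlap, integral_const]
  field_simp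
  simp

lemma integrableOn_tail_of_neg {P : Measure Ω} [IsProbabilityMeasure P] {Y : Ω → ℝ≥0∞}
    {κ : ℝ} (hκ : κ < 0) : IntegrableOn
      (fun t : ℝ => Real.exp (κ * t) * P.real {ω | ENNReal.ofReal t < Y ω}) (Set.Ioi 0) := by
  refine (integrableOn_exp_mul_Ioi hκ 0).mono' ?_ (Filter.Eventually.of_forall fun t => ?_)
  · have hm : Measurable fun t : ℝ => P.real {ω | ENNReal.ofReal t < Y ω} := by
      refine Antitone.measurable fun s t hst => measureReal_mono fun ω h => ?_
      exact (ENNReal.ofReal_le_ofReal hst).trans_lt h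
    exact (Measurable.mul (by fun_prop) hm).aestronglyMeasurable
  · rw [Real.norm_eq_abs, abs_of_nonneg (by positivity)]
    exact mul_le_of_le_one_right (Real.exp_pos _).le measureReal_le_one

/-- Tonelli in the other order: for real `κ` the kernel is nonnegative, and its inner integral `(exp
(κY) - 1) / κ` is integrable by hypothesis. -/
lemma integrableOn_tail_of_integrable_exp {P : Measure Ω} [IsProbabilityMeasure P] {Y : Ω → ℝ≥0∞}
    (hY : Measurable Y) {κ : ℝ} (hκ : κ ≠ 0) (hfin : ∀ᵐ ω ∂P, Y ω < ∞)
    (h : Integrable (fun ω => Real.exp (κ * (Y ω).toReal)) P) : IntegrableOn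
      (fun t : ℝ => Real.exp (κ * t) * P.real {ω | ENNReal.ofReal t < Y ω}) (Set.Ioi 0) := by
  have hm := measurable_tail_kernel hY (κ : ℂ)
  have hnorm : ∀ (ω : Ω) (t : ℝ),
      ‖{t | ENNReal.ofReal t < Y ω}.indicator (fun t : ℝ => Complex.exp (κ * t)) t‖
      = {t | ENNReal.ofReal t < Y ω}.indicator (fun t : ℝ => Real.exp (κ * t)) t := by
    intro ω t
    rw [norm_indicator_eq_indicator_norm]
    simp [Set.indicator_apply, norm_exp_mul_ofReal]
  have hk : Integrable (Function.uncurry fun (ω : Ω) (t : ℝ) =>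
      {t | ENNReal.ofReal t < Y ω}.indicator (fun t : ℝ => Complex.exp (κ * t)) t)
      (P.prod (volume.restrict (Set.Ioi 0))) := by
    rw [integrable_prod_iff (by exact hm.aestronglyMeasurable)]
    constructor
    · filter_upwards [hfin] with ω hω
      have hms : MeasurableSet {t : ℝ | ENNReal.ofReal t < Y ω} :=
        measurableSet_lt ENNReal.measurable_ofReal measurable_const
      simp only [Function.uncurry]
      rw [integrable_indicator_iff hms]
      rw [IntegrableOn, Measure.restrict_restrict hms]
      refine IntegrableOn.mono_set (t := Set.Icc 0 (Y ω).toReal)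
        (Continuous.integrableOn_Icc (by fun_prop)) ?_
      rintro t ⟨ht1, ht2⟩
      exact ⟨le_of_lt ht2, ((ENNReal.ofReal_lt_iff_lt_toReal (le_of_lt ht2) hω.ne).1 ht1).le⟩
    · simp only [Function.uncurry, hnorm]
      refine ((h.sub (integrable_const 1)).div_const κ).congr ?_
      filter_upwards [hfin] with ω hω
      rw [setIntegral_indicator_ofReal_lt _ hω.ne,
        intervalIntegral.integral_comp_mul_left (fun t => Real.exp t) hκ, integral_exp]
      simp [div_eq_inv_mul]
  have := hk.norm.integral_prod_right
  simp only [Function.uncurry, integral_norm_tail_kernel P hY, Complex.ofReal_re] at this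
  exact this

/-- The inversion formula for the probability that `ε` precedes the minimum `M` of a time `σ` and
an independent exponential time of rate `2 Λ`. -/
theorem hasInverseLaplaceAt_fillTransform {P : Measure Ω} [IsProbabilityMeasure P]
    {ε σ M : Ω → ℝ≥0∞} (hε : Measurable ε) (hσ : Measurable σ) (hM : Measurable M)
    (hind : IndepFun ε M P) {Λ : ℝ}
    (htail : ∀ t : ℝ≥0, P.real {ω | (t : ℝ≥0∞) < M ω}
      = P.real {ω | (t : ℝ≥0∞) < σ ω} * Real.exp (-(2 * Λ * t)))
    (htie : ∀ᵐ ω ∂P, ε ω ≠ ∞ → ε ω ≠ M ω) {c : ℝ} (hc : 0 < c)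
    (hconv : c < 2 * Λ ∨ (2 * Λ < c ∧ (∀ᵐ ω ∂P, σ ω < ∞) ∧
      Integrable (fun ω => Real.exp ((c - 2 * Λ) * (σ ω).toReal)) P)) :
    HasInverseLaplaceAt (fillTransform (laplace P ε) (laplace P σ) Λ) c 0
      (P.real {ω | ε ω < M ω} : ℝ) := by
  have htail' : ∀ t : ℝ, 0 < t → P.real {ω | ENNReal.ofReal t < M ω}
      = P.real {ω | ENNReal.ofReal t < σ ω} * Real.exp (-(2 * Λ * t)) := by
    intro t ht
    have := htail t.toNNReal
    rwa [Real.coe_toNNReal _ ht.le] at this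
  have hσint : IntegrableOn (fun t : ℝ => Real.exp ((c - 2 * Λ) * t)
      * P.real {ω | ENNReal.ofReal t < σ ω}) (Set.Ioi 0) := by
    rcases hconv with h | ⟨h1, h2, h3⟩
    · exact integrableOn_tail_of_neg (by linarith)
    · exact integrableOn_tail_of_integrable_exp hσ (by linarith) h2 h3
  have hMint : IntegrableOn (fun t : ℝ => Real.exp (c * t)
      * P.real {ω | ENNReal.ofReal t < M ω}) (Set.Ioi 0) := by
    refine hσint.congr_fun (fun t ht => ?_) measurableSet_Ioi
    simp only
    rw [htail' t ht, mul_left_comm, ← Real.exp_add, mul_comm]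
    congr 2
    ring
  -- For `t > 0` the integrable function `exp (ct) P(M > t)` dominates the constant `P(M = ∞)`,
  -- which must therefore be `0` on a half-line of infinite length.
  have hMfin : ∀ᵐ ω ∂P, M ω < ∞ := by
    have hconst : IntegrableOn (fun _ : ℝ => P.real {ω | M ω = ∞}) (Set.Ioi 0) := by
      refine hMint.mono' aestronglyMeasurable_const ?_
      filter_upwards [ae_restrict_mem measurableSet_Ioi] with t ht
      rw [Real.norm_eq_abs, abs_of_nonneg measureReal_nonneg]
      have ht' : (0 : ℝ) < t := ht
      calc P.real {ω | M ω = ∞} ≤ P.real {ω | ENNReal.ofReal t < M ω} :=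
            measureReal_mono fun ω (h : M ω = ∞) => by simp [h]
        _ ≤ _ := le_mul_of_one_le_left measureReal_nonneg (Real.one_le_exp (by positivity))
    rw [integrableOn_const_iff] at hconst
    have h0 : P {ω | M ω = ∞} = 0 := by
      rcases hconst with h | h
      · rw [enorm_eq_zero] at h
        exact (measureReal_eq_zero_iff (by finiteness)).1 h
      · simp at h
    rw [ae_iff]
    simpa using h0
  have hMc := laplace_neg_sub_one_eq hM (z := (c : ℂ)) (by exact_mod_cast hc.ne') (.inr hMfin)
    (by simpa using hMint)
  have hfinM : MeasurableSet {ω | M ω < ∞} := measurableSet_lt hM measurable_const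
  have hfinε : MeasurableSet {ω | ε ω < ∞} := measurableSet_lt hε measurable_const
  have hfac : ∀ s : ℂ, s.re = c → fillTransform (laplace P ε) (laplace P σ) Λ s
      = 1 / s * ∫ ω in {ω | ε ω < ∞},
        Complex.exp (s * (((M ω).toReal - (ε ω).toReal : ℝ) : ℂ)) ∂P := by
    intro s hs
    have hs0 : s ≠ 0 := by rintro rfl; simp at hs; linarith
    have hre : (s - 2 * Λ).re = c - 2 * Λ := by simp [hs]
    have hs1 : s - 2 * Λ ≠ 0 := by
      intro h
      rw [h, Complex.zero_re] at hre
      rcases hconv with h | ⟨h, -⟩ <;> linarith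
    have e1 := (laplace_neg_sub_one_eq hσ hs1 (by
      rw [hre]
      rcases hconv with h | ⟨-, h, -⟩
      · exact .inl (by linarith)
      · exact .inr h) (by rw [hre]; exact hσint)).2
    have e2 := (laplace_neg_sub_one_eq hM hs0 (.inr hMfin) (by rw [hs]; exact hMint)).2
    -- The factor `exp (-2Λt)` in the tail of `M` shifts the transform variable from `s` to `s -
    -- 2Λ`; this links the transforms of `M` and `σ`.
    have e3 : ∫ t in Set.Ioi (0 : ℝ), Complex.exp (s * t) * P.real {ω | ENNReal.ofReal t < M ω}
        = ∫ t in Set.Ioi (0 : ℝ),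
          Complex.exp ((s - 2 * Λ) * t) * P.real {ω | ENNReal.ofReal t < σ ω} := by
      refine setIntegral_congr_fun measurableSet_Ioi fun t ht => ?_
      rw [htail' t ht]
      push_cast
      rw [mul_left_comm, ← Complex.exp_add, mul_comm]
      congr 2
      ring
    rw [neg_sub] at e1
    rw [e3] at e2
    have e4 : (2 * Λ - s : ℂ) ≠ 0 := by rw [← neg_sub]; exact neg_ne_zero.mpr hs1
    have e5 : laplace P σ (2 * Λ - s)
        + 2 * Λ / (2 * Λ - s) * (1 - laplace P σ (2 * Λ - s)) = laplace P M (-s) := by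
      have : laplace P M (-s) = 1 + s / (s - 2 * Λ) * (laplace P σ (2 * Λ - s) - 1) := by
        rw [e1, ← mul_assoc, div_mul_cancel₀ _ hs1, ← e2]; ring
      rw [this, ← neg_sub (2 * Λ : ℂ) s]
      field_simp
      ring
    rw [fillTransform, e5, mul_assoc]
    congr 1
    have hind' : IndepFun
        (fun ω => {x : ℝ≥0∞ | x < ∞}.indicator (fun x => Complex.exp (-s * x.toReal)) (ε ω))
        (fun ω => {x : ℝ≥0∞ | x < ∞}.indicator (fun x => Complex.exp (s * x.toReal)) (M ω)) P :=
      hind.comp (φ := fun x => {x : ℝ≥0∞ | x < ∞}.indicator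
          (fun x => Complex.exp (-s * x.toReal)) x)
        (ψ := fun x => {x : ℝ≥0∞ | x < ∞}.indicator (fun x => Complex.exp (s * x.toReal)) x)
        (Measurable.indicator (by fun_prop) measurableSet_Iio)
        (Measurable.indicator (by fun_prop) measurableSet_Iio)
    have hmε : Measurable fun ω =>
        {x : ℝ≥0∞ | x < ∞}.indicator (fun x => Complex.exp (-s * x.toReal)) (ε ω) :=
      (Measurable.indicator (by fun_prop) measurableSet_Iio).comp hε
    have hmM : Measurable fun ω =>
        {x : ℝ≥0∞ | x < ∞}.indicator (fun x => Complex.exp (s * x.toReal)) (M ω) :=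
      (Measurable.indicator (by fun_prop) measurableSet_Iio).comp hM
    have hmul := hind'.integral_fun_mul_eq_mul_integral hmε.aestronglyMeasurable
      hmM.aestronglyMeasurable
    have l1 : laplace P ε s = ∫ ω, {x : ℝ≥0∞ | x < ∞}.indicator
        (fun x => Complex.exp (-s * x.toReal)) (ε ω) ∂P := by
      rw [laplace, ← integral_indicator hfinε]
      simp [Set.indicator_apply]
    have l2 : laplace P M (-s) = ∫ ω, {x : ℝ≥0∞ | x < ∞}.indicator
        (fun x => Complex.exp (s * x.toReal)) (M ω) ∂P := by
      rw [laplace, ← integral_indicator hfinM]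
      simp [Set.indicator_apply]
    rw [l1, l2, ← hmul, ← integral_indicator hfinε]
    refine integral_congr_ae ?_
    filter_upwards [hMfin] with ω hω
    by_cases h : ε ω < ∞
    · simp only [Set.indicator_apply, Set.mem_ofPred_eq, h, hω, if_true]
      rw [← Complex.exp_add]
      congr 1
      push_cast
      ring
    · simp [Set.indicator_apply, h]
  -- Since `ε ≥ 0`, the function `exp (cM)` dominates.
  have hexp : Integrable (fun ω => Real.exp (c * ((M ω).toReal - (ε ω).toReal)))
      (P.restrict {ω | ε ω < ∞}) := by
    have h1 : Integrable (fun ω => Real.exp (c * (M ω).toReal)) P := by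
      have := hMc.1.norm
      simp only [norm_exp_mul_ofReal, Complex.ofReal_re] at this
      have hres : P.restrict {ω | M ω < ∞} = P := Measure.restrict_eq_self_of_ae_mem hMfin
      rwa [hres] at this
    refine h1.restrict.mono' (Measurable.aestronglyMeasurable (by fun_prop))
      (Filter.Eventually.of_forall fun ω => ?_)
    rw [Real.norm_eq_abs, abs_of_pos (Real.exp_pos _)]
    gcongr
    linarith [ENNReal.toReal_nonneg (a := ε ω)]
  have hY0 : ∀ᵐ ω ∂(P.restrict {ω | ε ω < ∞}), (M ω).toReal - (ε ω).toReal ≠ 0 := by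
    rw [ae_restrict_iff' hfinε]
    filter_upwards [htie, hMfin] with ω h1 h2 h3 h4
    have h3' : ε ω ≠ ∞ := ne_of_lt h3
    exact h1 h3' ((ENNReal.toReal_eq_toReal_iff' h3' h2.ne).1 (by linarith))
  have hmain := hasInverseLaplaceAt_zero (P.restrict {ω | ε ω < ∞})
    (Y := fun ω => (M ω).toReal - (ε ω).toReal) (by fun_prop) hY0 hc hexp hfac
  convert hmain using 2
  rw [measureReal_restrict_apply (measurableSet_lt measurable_const (by fun_prop))]
  refine measureReal_congr ?_
  filter_upwards [hMfin] with ω hω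
  refine propext ⟨fun h : ε ω < M ω => ?_, fun h => ?_⟩
  · exact ⟨sub_pos.2 ((ENNReal.toReal_lt_toReal h.ne_top hω.ne).2 h), h.trans hω⟩
  · have h2 : ε ω ≠ ∞ := ne_of_lt h.2
    exact (ENNReal.toReal_lt_toReal h2 hω.ne).1 (sub_pos.1 h.1)

end RandomTimes

/-! ### Best quotes of a book -/

@[simp] lemma Side.opp_opp (k : Side) : k.opp.opp = k := by cases k <;> rfl

lemma bestAsk_le {N l : ℕ} {x : Book} (h1 : 1 ≤ l) (h2 : l ≤ N) (hx : 0 < x l) :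
    bestAsk N x ≤ l :=
  Nat.sInf_le (.inl ⟨h1, h2, hx⟩)

lemma le_bestAsk {N l : ℕ} {x : Book} (hl : l ≤ N + 1) (hx : ∀ k < l, x k ≤ 0) :
    l ≤ bestAsk N x := by
  refine le_csInf ⟨N + 1, .inr rfl⟩ ?_
  rintro k (⟨-, -, hk⟩ | rfl)
  · by_contra h
    exact (hx k (by omega)).not_gt hk
  · exact hl

lemma bestBid_bddAbove (N : ℕ) (x : Book) :
    BddAbove ({l | 1 ≤ l ∧ l ≤ N ∧ x l < 0} ∪ {0}) := by
  refine ⟨N, ?_⟩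
  rintro k (⟨-, hk, -⟩ | rfl)
  · exact hk
  · exact Nat.zero_le _

lemma le_bestBid {N l : ℕ} {x : Book} (h1 : 1 ≤ l) (h2 : l ≤ N) (hx : x l < 0) :
    l ≤ bestBid N x :=
  le_csSup (bestBid_bddAbove N x) (.inl ⟨h1, h2, hx⟩)

lemma bestBid_le {N l : ℕ} {x : Book} (hx : ∀ k, l < k → 0 ≤ x k) : bestBid N x ≤ l := by
  refine csSup_le ⟨0, .inr rfl⟩ ?_
  rintro k (⟨-, -, hk⟩ | rfl)
  · by_contra h
    exact (hx k (by omega)).not_gt hk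
  · exact Nat.zero_le _

lemma midPrice_congr {N : ℕ} {x y : Book} (h : ∀ l ≤ N, x l = y l) :
    midPrice N x = midPrice N y := by
  have h1 : {l | 1 ≤ l ∧ l ≤ N ∧ 0 < x l} = {l | 1 ≤ l ∧ l ≤ N ∧ 0 < y l} := by
    ext l
    simp only [Set.mem_ofPred_eq]
    refine and_congr_right fun _ => and_congr_right fun hl => by rw [h l hl]
  have h2 : {l | 1 ≤ l ∧ l ≤ N ∧ x l < 0} = {l | 1 ≤ l ∧ l ≤ N ∧ y l < 0} := by
    ext l
    simp only [Set.mem_ofPred_eq]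
    refine and_congr_right fun _ => and_congr_right fun hl => by rw [h l hl]
  unfold midPrice bestAsk bestBid
  rw [h1, h2]

/-- Only the finitely many levels up to `N` matter, so right-continuity level by level suffices. -/
lemma eventually_midPrice_eq {N : ℕ} {x : ℝ≥0 → Book}
    (hx : ∀ t l, ∀ᶠ u in 𝓝[>] t, x u l = x t l) (t : ℝ≥0) :
    ∀ᶠ u in 𝓝[>] t, midPrice N (x u) = midPrice N (x t) := by
  have h := ((Set.finite_Iic N).eventually_all (l := 𝓝[>] t)
    (p := fun l u => x u l = x t l)).2 fun l _ => hx t l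
  exact h.mono fun u hu => midPrice_congr fun l hl => hu l hl

/-! ### How the best quotes respond to arrivals inside the spread and to an emptied level. -/

section Quotes

variable {N s₀ a b : ℕ} {y : Book}

lemma quote_eq_of_pos (hb : 1 ≤ b) (ha : a ≤ N) (hab : a = b + (s₀ + 1))
    (hcross : ∀ l, (l ≤ b → y l ≤ 0) ∧ (a ≤ l → 0 ≤ y l)) {k : Side}
    (hinside : ∀ r : Fin s₀, ¬ 0 < k.sign * y (k.insideLevel a b r))
    (hown : 0 < k.sign * y (k.quote a b)) :
    k.quote (bestAsk N y) (bestBid N y) = k.quote a b := by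
  cases k
  · simp only [Side.quote, Side.sign, Side.insideLevel, one_mul, not_lt] at *
    refine le_antisymm (bestAsk_le (by omega) ha hown) (le_bestAsk (by omega) fun l hl => ?_)
    rcases le_or_gt l b with h | h
    · exact (hcross l).1 h
    -- A level `l` strictly inside the spread is the one indexed by `r` with `a - (r + 1) = l`.
    · have := hinside ⟨a - l - 1, by omega⟩
      rwa [show a - (a - l - 1 + 1) = l by omega] at this
  · simp only [Side.quote, Side.sign, Side.insideLevel, neg_mul, one_mul, not_lt,
      Left.neg_pos_iff] at *
    refine le_antisymm (bestBid_le fun l hl => ?_) (le_bestBid hb (by omega) hown)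
    rcases le_or_gt a l with h | h
    · exact (hcross l).2 h
    · have := hinside ⟨l - b - 1, by omega⟩
      rwa [show b + (l - b - 1 + 1) = l by omega] at this

lemma quote_ne_of_inside (hb : 1 ≤ b) (ha : a ≤ N) (hab : a = b + (s₀ + 1)) {k : Side}
    {r : Fin s₀} (hinside : 0 < k.sign * y (k.insideLevel a b r)) :
    k.quote (bestAsk N y) (bestBid N y) ≠ k.quote a b := by
  have := r.2
  cases k
  · simp only [Side.quote, Side.sign, Side.insideLevel, one_mul] at *
    have := bestAsk_le (N := N) (l := a - ((r : ℕ) + 1)) (by omega) (by omega) hinside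
    omega
  · simp only [Side.quote, Side.sign, Side.insideLevel, neg_mul, one_mul, Left.neg_pos_iff] at *
    have := le_bestBid (N := N) (l := b + ((r : ℕ) + 1)) (by omega) (by omega) hinside
    omega

lemma quote_ne_of_empty (hb : 1 ≤ b) (ha : a ≤ N) (hab : a = b + (s₀ + 1))
    (hcross : ∀ l, (l ≤ b → y l ≤ 0) ∧ (a ≤ l → 0 ≤ y l)) {k : Side}
    (hinside : ∀ r : Fin s₀, ¬ 0 < k.sign * y (k.insideLevel a b r))
    (hown : y (k.quote a b) = 0) :
    k.quote (bestAsk N y) (bestBid N y) ≠ k.quote a b := by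
  cases k
  · simp only [Side.quote, Side.sign, Side.insideLevel, one_mul, not_lt] at *
    -- Even for an empty ask side this holds: the default `N + 1` is at least `a + 1` because `a ≤
    -- N`.
    have : a + 1 ≤ bestAsk N y := by
      refine le_bestAsk (by omega) fun l hl => ?_
      rcases le_or_gt l b with h | h
      · exact (hcross l).1 h
      · rcases eq_or_ne l a with rfl | hne
        · exact hown.le
        · have := hinside ⟨a - l - 1, by omega⟩
          rwa [show a - (a - l - 1 + 1) = l by omega] at this
    omega
  · simp only [Side.quote, Side.sign, Side.insideLevel, neg_mul, one_mul, not_lt,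
      Left.neg_nonpos_iff] at *
    -- The natural subtraction is genuine because `b ≥ 1`, so the bid drops strictly, possibly to
    -- the default `0`.
    have : bestBid N y ≤ b - 1 := by
      refine bestBid_le fun l hl => ?_
      rcases le_or_gt a l with h | h
      · exact (hcross l).2 h
      · rcases eq_or_ne l b with rfl | hne
        · exact hown.ge
        · have := hinside ⟨l - b - 1, by omega⟩
          rwa [show b + (l - b - 1 + 1) = l by omega] at this
    omega

lemma midPrice_eq_of_quotes (h : ∀ k : Side, k.quote (bestAsk N y) (bestBid N y) = k.quote a b) :
    midPrice N y = ((b : ℝ) + a) / 2 := by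
  have h1 := h .ask
  have h2 := h .bid
  simp only [Side.quote] at h1 h2
  rw [midPrice, h1, h2]

/-- The other quote has to stay put: equal and opposite moves of both quotes would cancel in the
mid-price. -/
lemma midPrice_ne_of_quotes {k : Side}
    (h : k.quote (bestAsk N y) (bestBid N y) ≠ k.quote a b)
    (h' : k.opp.quote (bestAsk N y) (bestBid N y) = k.opp.quote a b) :
    midPrice N y ≠ ((b : ℝ) + a) / 2 := by
  intro hm
  rw [midPrice] at hm
  cases k <;> simp only [Side.quote, Side.opp] at h h'
  · rw [h'] at hm
    exact h (by exact_mod_cast (by linarith : (bestAsk N y : ℝ) = a))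
  · rw [h'] at hm
    exact h (by exact_mod_cast (by linarith : (bestBid N y : ℝ) = b))

end Quotes

/-! ### One trajectory of the book after the quote time -/

/-- A trajectory `x` of the book and `w` of the order's position, driven by the position `d`, the
opposite queue `β` and the arrival times `T`, without simultaneous arrivals. Here `M` is the first
of all the times that can move the mid-price while the order's level is not empty. -/
structure IsDrivenPath (N : ℕ) (i : Side) (s₀ a b : ℕ) (x : ℝ≥0 → Book) (w d β : ℝ≥0 → ℕ)
    (T : Side → Fin s₀ → ℝ≥0∞) (M : ℝ≥0∞) : Prop where
  book_right : ∀ t l, ∀ᶠ u in 𝓝[>] t, x u l = x t l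
  position_right : ∀ t, ∀ᶠ u in 𝓝[>] t, w u = w t
  death_right : ∀ t, ∀ᶠ u in 𝓝[>] t, d u = d t
  queue_right : ∀ t, ∀ᶠ u in 𝓝[>] t, β u = β t
  death_start : d 0 ≠ 0
  min_pos : 0 < M
  min_le_queue : M ≤ firstTime fun t => β t = 0
  min_le_arrival : ∀ k r, M ≤ T k r
  min_mem : (M = firstTime fun t => β t = 0) ∨ ∃ k r, M = T k r
  arrival_ne_queue : ∀ k r, T k r ≠ ∞ → T k r ≠ firstTime fun t => β t = 0
  arrival_ne_arrival : ∀ k r r', T k r ≠ ∞ → T k r ≠ T k.opp r'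
  death_ne_min : (firstTime fun t => d t = 0) ≠ ∞ → (firstTime fun t => d t = 0) ≠ M
  position_eq : ∀ u : ℝ≥0, (u : ℝ≥0∞) ≤ firstTime (fun u => midPrice N (x u) ≠ midPrice N (x 0)) →
    w u = d u
  opposite_eq : ∀ u : ℝ≥0, (u : ℝ≥0∞) ≤ firstTime (fun u => midPrice N (x u) ≠ midPrice N (x 0)) →
    x u (i.opp.quote a b) = i.opp.sign * (β u : ℤ)
  inside_iff : ∀ u : ℝ≥0, (u : ℝ≥0∞) ≤ firstTime (fun u => midPrice N (x u) ≠ midPrice N (x 0)) →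
    ∀ k r, (0 < k.sign * x u (k.insideLevel a b r) ↔ T k r ≤ u)
  own_queue : ∀ u : ℝ≥0, (u : ℝ≥0∞) ≤ firstTime (fun u => midPrice N (x u) ≠ midPrice N (x 0)) →
    (d u : ℤ) ≤ i.sign * x u (i.quote a b)
  no_crossing : ∀ u : ℝ≥0, (u : ℝ≥0∞) ≤ firstTime (fun u => midPrice N (x u) ≠ midPrice N (x 0)) →
    ∀ l, (l ≤ b → x u l ≤ 0) ∧ (a ≤ l → 0 ≤ x u l)

namespace IsDrivenPath

variable {N : ℕ} {i : Side} {s₀ a b : ℕ} {x : ℝ≥0 → Book} {w d β : ℝ≥0 → ℕ}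
  {T : Side → Fin s₀ → ℝ≥0∞} {M : ℝ≥0∞} {u : ℝ≥0}

local notation "nextMid" => firstTime (fun u => midPrice N (x u) ≠ midPrice N (x 0))

lemma opposite_pos (hp : IsDrivenPath N i s₀ a b x w d β T M) (hu : (u : ℝ≥0∞) ≤ nextMid)
    (hβ : β u ≠ 0) : 0 < i.opp.sign * x u (i.opp.quote a b) := by
  have hs : i.opp.sign * i.opp.sign = 1 := by cases i <;> rfl
  rw [hp.opposite_eq u hu, ← mul_assoc, hs, one_mul]
  omega

lemma sides_pos (hp : IsDrivenPath N i s₀ a b x w d β T M) (hu : (u : ℝ≥0∞) ≤ nextMid)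
    (hβ : β u ≠ 0) (hown : 0 < i.sign * x u (i.quote a b)) (k : Side) :
    0 < k.sign * x u (k.quote a b) := by
  have h := hp.opposite_pos hu hβ
  cases i <;> cases k <;> assumption

/-- Before `M` the spread is empty inside and the opposite queue is alive. Positivity of the own
queue is assumed directly, not through `d`, so that the lemma also applies at the fill itself. -/
lemma midPrice_of_lt_min (hp : IsDrivenPath N i s₀ a b x w d β T M) (hb : 1 ≤ b) (ha : a ≤ N)
    (hab : a = b + (s₀ + 1)) (hu : (u : ℝ≥0∞) ≤ nextMid) (huM : (u : ℝ≥0∞) < M)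
    (hown : 0 < i.sign * x u (i.quote a b)) : midPrice N (x u) = ((b : ℝ) + a) / 2 :=
  midPrice_eq_of_quotes fun k => quote_eq_of_pos hb ha hab (hp.no_crossing u hu)
    (fun r h => ((hp.inside_iff u hu k r).1 h).not_gt (huM.trans_le (hp.min_le_arrival k r)))
    (hp.sides_pos hu (not_of_lt_firstTime (huM.trans_le hp.min_le_queue)) hown k)

lemma own_pos (hp : IsDrivenPath N i s₀ a b x w d β T M) (hu : (u : ℝ≥0∞) ≤ nextMid)
    (hd : d u ≠ 0) : 0 < i.sign * x u (i.quote a b) := by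
  have := hp.own_queue u hu
  omega

lemma midPrice_start (hp : IsDrivenPath N i s₀ a b x w d β T M) (hb : 1 ≤ b) (ha : a ≤ N)
    (hab : a = b + (s₀ + 1)) : midPrice N (x 0) = ((b : ℝ) + a) / 2 :=
  hp.midPrice_of_lt_min hb ha hab (by simp) (by simpa using hp.min_pos)
    (hp.own_pos (by simp) hp.death_start)

/-- Without ties only one quote moves. Either the opposite queue empties with no arrival, or orders
arrive on one side while both old best queues are nonempty and the other side has no arrival.
Coincident arrivals on the same side do no harm. -/
lemma midPrice_of_eq_min (hp : IsDrivenPath N i s₀ a b x w d β T M) (hb : 1 ≤ b) (ha : a ≤ N)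
    (hab : a = b + (s₀ + 1)) (hu : (u : ℝ≥0∞) ≤ nextMid) (huM : M = u) (hd : d u ≠ 0) :
    midPrice N (x u) ≠ ((b : ℝ) + a) / 2 := by
  have hown := hp.own_pos hu hd
  rcases hp.min_mem with hM | ⟨k, r, hM⟩
  · have hβ : β u = 0 := firstTime_attained (A := fun t => β t = 0)
      (fun hn => (hp.queue_right u).mono fun v hv => by rwa [hv]) (hM.symm.trans huM)
    have hin : ∀ (k : Side) (r : Fin s₀), ¬ 0 < k.sign * x u (k.insideLevel a b r) := by
      intro k r h
      have h1 : T k r = M :=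
        le_antisymm (((hp.inside_iff u hu k r).1 h).trans huM.ge) (hp.min_le_arrival k r)
      exact hp.arrival_ne_queue k r (by rw [h1, huM]; simp) (h1.trans hM)
    refine midPrice_ne_of_quotes (k := i.opp)
      (quote_ne_of_empty hb ha hab (hp.no_crossing u hu) (hin _) ?_) ?_
    · rw [hp.opposite_eq u hu, hβ]
      simp
    · rw [Side.opp_opp]
      exact quote_eq_of_pos hb ha hab (hp.no_crossing u hu) (hin _) hown
  · have hfin : T k r ≠ ∞ := by rw [← hM, huM]; simp
    have hβ : β u ≠ 0 := by
      refine not_of_lt_firstTime (A := fun t => β t = 0) (huM ▸ hp.min_le_queue.lt_of_ne fun h => ?_)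
      exact hp.arrival_ne_queue k r hfin (hM.symm.trans h)
    refine midPrice_ne_of_quotes (k := k)
      (quote_ne_of_inside hb ha hab (r := r) ((hp.inside_iff u hu k r).2 (hM.symm.trans huM).le))
      (quote_eq_of_pos hb ha hab (hp.no_crossing u hu) (fun r' h => ?_) (hp.sides_pos hu hβ hown _))
    have h1 : T k.opp r' = M :=
      le_antisymm (((hp.inside_iff u hu _ r').1 h).trans huM.ge) (hp.min_le_arrival _ r')
    exact hp.arrival_ne_arrival k r r' hfin (hM.symm.trans h1.symm)

lemma nextMid_attained (hp : IsDrivenPath N i s₀ a b x w d β T M) (h : nextMid = u) :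
    midPrice N (x u) ≠ midPrice N (x 0) :=
  firstTime_attained (A := fun u => midPrice N (x u) ≠ midPrice N (x 0))
    (fun hn => (eventually_midPrice_eq hp.book_right u).mono fun v hv => by rwa [hv]) h

/-- The drivers describe the book only up to the next move, hence the argument by contradiction:
were the move later than `M`, the description would be valid at `M` and would show a move there. -/
lemma nextMid_le_min (hp : IsDrivenPath N i s₀ a b x w d β T M) (hb : 1 ≤ b) (ha : a ≤ N)
    (hab : a = b + (s₀ + 1)) (h : M < firstTime fun t => d t = 0) : nextMid ≤ M := by
  by_contra! hlt
  lift M to ℝ≥0 using h.ne_top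
  refine (hlt.trans_le (firstTime_le ?_)).false
  rw [hp.midPrice_start hb ha hab]
  exact hp.midPrice_of_eq_min hb ha hab hlt.le rfl (not_of_lt_firstTime h)

/-- A move strictly before the death time would happen before `M` with the order still in the queue,
where the mid-price is constant. The position thus follows `d` up to and including its death. -/
lemma fill_le_of_lt (hp : IsDrivenPath N i s₀ a b x w d β T M) (hb : 1 ≤ b) (ha : a ≤ N)
    (hab : a = b + (s₀ + 1)) (h : (firstTime fun t => d t = 0) < M) :
    (firstTime fun t => w t = 0) ≤ (firstTime fun t => d t = 0) ∧
      (firstTime fun t => d t = 0) ≤ nextMid := by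
  obtain ⟨e, he⟩ : ∃ t : ℝ≥0, (t : ℝ≥0∞) = _ := ⟨_, ENNReal.coe_toNNReal h.ne_top⟩
  have hle : (e : ℝ≥0∞) ≤ nextMid := by
    by_contra! hlt
    obtain ⟨v, hv⟩ : ∃ t : ℝ≥0, (t : ℝ≥0∞) = _ := ⟨_, ENNReal.coe_toNNReal hlt.ne_top⟩
    refine hp.nextMid_attained hv.symm ?_
    rw [hp.midPrice_start hb ha hab]
    rw [← hv] at hlt
    refine hp.midPrice_of_lt_min hb ha hab hv.le (hlt.trans (he ▸ h)) (hp.own_pos hv.le ?_)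
    exact not_of_lt_firstTime (A := fun t => d t = 0) (he ▸ hlt)
  have hd : d e = 0 := firstTime_attained (A := fun t => d t = 0)
    (fun hn => (hp.death_right e).mono fun v hv => by rwa [hv]) he.symm
  rw [← he]
  exact ⟨firstTime_le (by rw [hp.position_eq e hle, hd]), hle⟩

theorem fill_le_nextMid_iff (hp : IsDrivenPath N i s₀ a b x w d β T M) (hb : 1 ≤ b) (ha : a ≤ N)
    (hab : a = b + (s₀ + 1)) :
    ((firstTime fun t => w t = 0) < ∞ ∧ (firstTime fun t => w t = 0) ≤ nextMid) ↔
      (firstTime fun t => d t = 0) < M := by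
  constructor
  · rintro ⟨hfin, hle⟩
    obtain ⟨v, hv⟩ : ∃ t : ℝ≥0, (t : ℝ≥0∞) = _ := ⟨_, ENNReal.coe_toNNReal hfin.ne⟩
    have hw : w v = 0 := firstTime_attained (A := fun t => w t = 0)
      (fun hn => (hp.position_right v).mono fun u hu => by rwa [hu]) hv.symm
    rw [← hv] at hle
    have hd : (firstTime fun t => d t = 0) ≤ v :=
      firstTime_le (by rw [← hp.position_eq v hle, hw])
    -- Without ties `M` would strictly precede the death time, so the move would come before the
    -- death time, and the latter is at most the fill time.
    by_contra! hM
    have hM' := hM.lt_of_ne' (hp.death_ne_min (hd.trans_lt ENNReal.coe_lt_top).ne)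
    exact ((hp.nextMid_le_min hb ha hab hM').trans_lt (hM'.trans_le (hd.trans hle))).false
  · intro h
    obtain ⟨h1, h2⟩ := hp.fill_le_of_lt hb ha hab h
    exact ⟨(h1.trans_lt h).trans_le le_top, h1.trans h2⟩

/-- If fill and move coincided, the mid-price would change at a time before `M` at which the own
level is nonempty, which is impossible. -/
theorem fill_lt_nextMid_iff (hp : IsDrivenPath N i s₀ a b x w d β T M) (hb : 1 ≤ b) (ha : a ≤ N)
    (hab : a = b + (s₀ + 1))
    (hne : (firstTime fun t => w t = 0) < ∞ → (firstTime fun t => w t = 0) ≤ nextMid →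
      x (firstTime fun t => w t = 0).toNNReal (i.quote a b) ≠ 0) :
    (firstTime fun t => w t = 0) < nextMid ↔ (firstTime fun t => d t = 0) < M := by
  rw [← hp.fill_le_nextMid_iff hb ha hab]
  refine ⟨fun h => ⟨h.trans_le le_top, h.le⟩, fun h => h.2.lt_of_ne fun heq => ?_⟩
  obtain ⟨v, hv⟩ : ∃ t : ℝ≥0, (t : ℝ≥0∞) = _ := ⟨_, ENNReal.coe_toNNReal h.1.ne⟩
  have hlt := (hp.fill_le_nextMid_iff hb ha hab).1 h
  have h0 := hne h.1 h.2
  have hle := (hp.fill_le_of_lt hb ha hab hlt).1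
  rw [← hv] at heq h0 hle
  rw [ENNReal.toNNReal_coe] at h0
  refine hp.nextMid_attained heq.symm ?_
  rw [hp.midPrice_start hb ha hab]
  refine hp.midPrice_of_lt_min hb ha hab heq.le (hle.trans_lt hlt) ?_
  -- The signed queue is at least `d v ≥ 0` and nonzero, hence positive.
  have h1 := hp.own_queue v heq.le
  have h2 : i.sign * x v (i.quote a b) ≠ 0 := mul_ne_zero (by cases i <;> decide) h0
  omega

end IsDrivenPath

variable {Ω : Type*}

/-! ### The first passage and arrival times of the order flow -/

/-- The random time read off from each source of randomness. -/
noncomputable def driverTime {s₀ : ℕ} (D B : ℝ≥0 → Ω → ℕ) (T : Side → Fin s₀ → Ω → ℝ≥0∞) :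
    Driver s₀ → Ω → ℝ≥0∞
  | .position => passageTime D
  | .opposite => passageTime B
  | .arrival k r => T k r

/-- The labels of the arrivals of one side. -/
def sideArrivals (s₀ : ℕ) (k : Side) : Finset (Driver s₀) :=
  Finset.univ.map ⟨Driver.arrival k, fun r r' h => by injection h⟩

open Classical in
/-- All labels but that of the order's position. -/
noncomputable def otherDrivers (s₀ : ℕ) : Finset (Driver s₀) :=
  insert .opposite (sideArrivals s₀ .ask ∪ sideArrivals s₀ .bid)

lemma mem_sideArrivals {s₀ : ℕ} {k : Side} {e : Driver s₀} :
    e ∈ sideArrivals s₀ k ↔ ∃ r, Driver.arrival k r = e := by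
  simp only [sideArrivals, Finset.mem_map, Finset.mem_univ, true_and]
  rfl

lemma mem_otherDrivers {s₀ : ℕ} {e : Driver s₀} : e ∈ otherDrivers s₀ ↔ e ≠ .position := by
  classical
  simp only [otherDrivers, Finset.mem_insert, Finset.mem_union, mem_sideArrivals]
  constructor
  · rintro (rfl | ⟨r, rfl⟩ | ⟨r, rfl⟩) <;> simp
  · intro h
    rcases e with _ | _ | ⟨k, r⟩
    · exact absurd rfl h
    · exact .inl rfl
    · cases k
      · exact .inr (.inl ⟨r, rfl⟩)
      · exact .inr (.inr ⟨r, rfl⟩)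

lemma prod_otherDrivers {s₀ : ℕ} (f : Driver s₀ → ℝ) :
    ∏ e ∈ otherDrivers s₀, f e
      = f .opposite * ((∏ r, f (.arrival .ask r)) * ∏ r, f (.arrival .bid r)) := by
  classical
  rw [otherDrivers, Finset.prod_insert, Finset.prod_union]
  · simp only [sideArrivals, Finset.prod_map]
    rfl
  · rw [Finset.disjoint_left]
    intro e h1 h2
    obtain ⟨r, rfl⟩ := mem_sideArrivals.1 h1
    obtain ⟨r', h⟩ := mem_sideArrivals.1 h2
    simp at h
  · simp [mem_sideArrivals]

lemma eventually_shift {p : ℝ≥0 → Prop} {q t : ℝ≥0} (h : ∀ᶠ v in 𝓝[>] (q + t), p v) :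
    ∀ᶠ u in 𝓝[>] t, p (q + u) := by
  have : Tendsto (fun u => q + u) (𝓝[>] t) (𝓝[>] (q + t)) := by
    refine tendsto_nhdsWithin_iff.2 ⟨?_, ?_⟩
    · exact (Continuous.tendsto (by fun_prop) t).mono_left nhdsWithin_le_nhds
    · filter_upwards [self_mem_nhdsWithin] with u hu
      exact add_lt_add_right (show t < u from hu) q
  exact this.eventually h

namespace PostQuoteFlow

variable [MeasurableSpace Ω] {𝒳 : Type*} {P : Measure Ω} {N : ℕ} {i : Side}
  {Q : ℝ≥0 → Ω → Book} {W : ℝ≥0 → Ω → ℕ} {R : Intensities 𝒳} {X : ℕ → ℕ → ℕ → 𝒳}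
  {s₀ a b m n : ℕ} {D B : ℝ≥0 → Ω → ℕ} {T : Side → Fin s₀ → Ω → ℝ≥0∞}

lemma measurable_driverTime (hflow : PostQuoteFlow P N i Q W R X s₀ a b m n D B T)
    (e : Driver s₀) : Measurable (driverTime D B T e) := by
  rcases e with _ | _ | ⟨k, r⟩
  · exact measurable_passageTime hflow.position_law.measurable hflow.position_law.right_continuous
  · exact measurable_passageTime hflow.opposite_law.measurable hflow.opposite_law.right_continuous
  · exact (hflow.arrival_law k r).measurable

/-- Each time is measurable with respect to its own source, so it inherits the independence of the
sources. -/
lemma iIndepFun_driverTime (hflow : PostQuoteFlow P N i Q W R X s₀ a b m n D B T) :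
    iIndepFun (driverTime D B T) P := by
  have hsub : ∀ (Z : ℝ≥0 → Ω → ℕ) (t : ℝ≥0),
      Measurable[⨆ t, MeasurableSpace.comap (Z t) ⊤] (Z t) := fun Z t =>
    (comap_measurable (Z t)).mono (le_iSup (fun t => MeasurableSpace.comap (Z t) ⊤) t) le_rfl
  have hm : ∀ e, Measurable[driverSigma D B T e] (driverTime D B T e) := by
    intro e
    rcases e with _ | _ | ⟨k, r⟩
    · exact measurable_passageTime (hsub D) hflow.position_law.right_continuous
    · exact measurable_passageTime (hsub B) hflow.opposite_law.right_continuous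
    · exact comap_measurable (T k r)
  exact iIndepFun_iff_measure_inter_preimage_eq_mul.2 fun S sets H =>
    hflow.independent.meas_biInter fun e he => hm e (H e he)

lemma ae_driverTime_ne [IsProbabilityMeasure P]
    (hflow : PostQuoteFlow P N i Q W R X s₀ a b m n D B T) (k : Side) (r : Fin s₀)
    {e : Driver s₀} (he : Driver.arrival k r ≠ e) :
    ∀ᵐ ω ∂P, T k r ω ≠ ∞ → T k r ω ≠ driverTime D B T e ω :=
  ae_ne_of_indepFun (hflow.arrival_law k r).measurable (hflow.measurable_driverTime e)
    (hflow.iIndepFun_driverTime.indepFun he) (hflow.arrival_law k r).measure_eq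

/-- The law of the first of the times that can move the mid-price while the order's level is not
empty. -/
lemma tail_inf (hflow : PostQuoteFlow P N i Q W R X s₀ a b m n D B T) {Λ : ℝ}
    (hΛask : Λ = ∑ r : Fin s₀, (R.lam .ask 0 (X (a - ((r : ℕ) + 1)) a b) : ℝ))
    (hΛbid : Λ = ∑ r : Fin s₀, (R.lam .bid 0 (X (b + ((r : ℕ) + 1)) a b) : ℝ)) (t : ℝ≥0) :
    P.real {ω | (t : ℝ≥0∞) < (otherDrivers s₀).inf fun e => driverTime D B T e ω}
      = P.real {ω | (t : ℝ≥0∞) < passageTime B ω} * Real.exp (-(2 * Λ * t)) := by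
  rw [measureReal_lt_finset_inf hflow.iIndepFun_driverTime, prod_otherDrivers]
  have h : ∀ k, ∏ r, P.real {ω | (t : ℝ≥0∞) < driverTime D B T (.arrival k r) ω}
      = Real.exp (-((∑ r : Fin s₀, (R.lam k 0 (X (k.insideLevel a b r) a b) : ℝ)) * t)) := by
    intro k
    rw [Finset.sum_mul, ← Finset.sum_neg_distrib, Real.exp_sum]
    exact Finset.prod_congr rfl fun r _ => (hflow.arrival_law k r).tail t
  have hask := h .ask
  have hbid := h .bid
  simp only [Side.insideLevel] at hask hbid
  rw [← hΛask] at hask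
  rw [← hΛbid] at hbid
  rw [hask, hbid, ← Real.exp_add]
  congr 2
  ring

/-- All probabilistic exceptions are discarded here: ties, arrivals at time `0`, wrong starting
points. What remains is deterministic. -/
lemma ae_isDrivenPath [IsProbabilityMeasure P]
    (hflow : PostQuoteFlow P N i Q W R X s₀ a b m n D B T)
    (hQr : ∀ ω t l, ∀ᶠ u in 𝓝[>] t, Q u ω l = Q t ω l)
    (hWr : ∀ ω t, ∀ᶠ u in 𝓝[>] t, W u ω = W t ω) (hm : 1 ≤ m) (hn : 1 ≤ n)
    (htie : ∀ᵐ ω ∂P, passageTime D ω ≠ ∞ →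
      passageTime D ω ≠ (otherDrivers s₀).inf fun e => driverTime D B T e ω) :
    ∀ᵐ ω ∂P, IsDrivenPath N i s₀ a b (fun u => shiftedBook N i Q u ω)
      (fun u => shiftedPosition N i Q W u ω) (fun u => D u ω) (fun u => B u ω)
      (fun k r => T k r ω) ((otherDrivers s₀).inf fun e => driverTime D B T e ω) := by
  have hside : ∀ {p : Side → Ω → Prop}, (∀ k, ∀ᵐ ω ∂P, p k ω) → ∀ᵐ ω ∂P, ∀ k, p k ω := by
    intro p h
    filter_upwards [h .ask, h .bid] with ω h1 h2 k
    cases k <;> assumption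
  have hTB : ∀ᵐ ω ∂P, ∀ k r, T k r ω ≠ ∞ → T k r ω ≠ passageTime B ω :=
    hside fun k => ae_all_iff.2 fun r => hflow.ae_driverTime_ne k r (e := .opposite) (by simp)
  have hTT : ∀ᵐ ω ∂P, ∀ k r r', T k r ω ≠ ∞ → T k r ω ≠ T k.opp r' ω :=
    hside fun k => ae_all_iff.2 fun r => ae_all_iff.2 fun r' =>
      hflow.ae_driverTime_ne k r (e := .arrival k.opp r') (by cases k <;> simp [Side.opp])
  have hTpos : ∀ᵐ ω ∂P, ∀ k r, T k r ω ≠ 0 :=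
    hside fun k => ae_all_iff.2 fun r => by
      rw [ae_iff]
      simpa using (hflow.arrival_law k r).measure_eq 0
  filter_upwards [hTB, hTT, hTpos, htie, hflow.position_law.start, hflow.opposite_law.start,
    hflow.position_eq, hflow.opposite_eq, hflow.inside_iff, hflow.own_queue, hflow.no_crossing]
    with ω h1 h2 h3 h4 h5 h6 h7 h8 h9 h10 h11
  have hBr := hflow.opposite_law.right_continuous ω
  have hmin : ∀ e : Driver s₀, e ≠ .position →
      (otherDrivers s₀).inf (fun e => driverTime D B T e ω) ≤ driverTime D B T e ω := fun e he =>
    Finset.inf_le (f := fun e => driverTime D B T e ω) (mem_otherDrivers.2 he)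
  have hmem : (otherDrivers s₀).inf (fun e => driverTime D B T e ω) = passageTime B ω ∨
      ∃ k r, (otherDrivers s₀).inf (fun e => driverTime D B T e ω) = T k r ω := by
    obtain ⟨e, he, heq⟩ := Finset.exists_mem_eq_inf (otherDrivers s₀)
      ⟨.opposite, mem_otherDrivers.2 (by simp)⟩ (fun e => driverTime D B T e ω)
    rcases e with _ | _ | ⟨k, r⟩
    · exact absurd rfl (mem_otherDrivers.1 he)
    · exact .inl heq
    · exact .inr ⟨k, r, heq⟩
  have hBpos : passageTime B ω ≠ 0 := fun h => by
    have : B 0 ω = 0 := firstTime_attained (A := fun t => B t ω = 0)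
      (fun hn => (hBr 0).mono fun v hv => by rwa [hv]) (show passageTime B ω = ((0 : ℝ≥0) : ℝ≥0∞) by simpa using h)
    omega
  exact
    { book_right := fun t l => eventually_shift (hQr ω _ l)
      position_right := fun t => eventually_shift (p := fun v => W v ω = W (_ + t) ω) (hWr ω _)
      death_right := hflow.position_law.right_continuous ω
      queue_right := hBr
      death_start := by omega
      min_pos := by
        rcases hmem with h | ⟨k, r, h⟩ <;> rw [h, pos_iff_ne_zero]
        · exact hBpos
        · exact h3 k r
      min_le_queue := hmin .opposite (by simp)
      min_le_arrival := fun k r => hmin (.arrival k r) (by simp)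
      min_mem := hmem
      arrival_ne_queue := h1
      arrival_ne_arrival := h2
      death_ne_min := h4
      position_eq := h7
      opposite_eq := h8
      inside_iff := h9
      own_queue := h10
      no_crossing := h11 }

end PostQuoteFlow

end LimitOrderBook

/-! ### The proposition under the conditional law -/

theorem mainTheorem5 {Ω : Type*} [MeasurableSpace Ω] {𝒳 : Type*}
    (P : Measure Ω) [IsProbabilityMeasure P]
    -- the grid, the side `i` of the order, the book and the order's queue position
    (N : ℕ) (i : Side) (Q : ℝ≥0 → Ω → Book) (W : ℝ≥0 → Ω → ℕ)
    (hQ : ∀ t, Measurable (Q t)) (hW : ∀ t, Measurable (W t))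
    (hQr : ∀ ω t l, ∀ᶠ u in 𝓝[>] t, Q u ω l = Q t ω l)
    (hWr : ∀ ω t, ∀ᶠ u in 𝓝[>] t, W u ω = W t ω)
    -- the intensities and the factor vectors
    (R : Intensities 𝒳) (X : ℕ → ℕ → ℕ → 𝒳)
    -- the initial spread, and the state at the quote time, when the spread is `s₀ + 1`
    (s₀ a b m n : ℕ) (hs₀ : 1 ≤ s₀) (hb : 1 ≤ b) (ha : a ≤ N) (hab : a = b + (s₀ + 1))
    (hm : 1 ≤ m) (hn : 1 ≤ n)
    (hC : P (quoteEvent N i Q W s₀ a b m n) ≠ 0)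
    -- the conditional law given the state at the quote time
    (P' : Measure Ω) (hP' : P' = P[|quoteEvent N i Q W s₀ a b m n])
    -- the order flow after the quote time
    (D B : ℝ≥0 → Ω → ℕ) (T : Side → Fin s₀ → Ω → ℝ≥0∞)
    (hflow : PostQuoteFlow P' N i Q W R X s₀ a b m n D B T)
    -- the total arrival rate inside the spread, the same on both sides
    (Λ : ℝ)
    (hΛask : Λ = ∑ r : Fin s₀, (R.lam .ask 0 (X (a - ((r : ℕ) + 1)) a b) : ℝ))
    (hΛbid : Λ = ∑ r : Fin s₀, (R.lam .bid 0 (X (b + ((r : ℕ) + 1)) a b) : ℝ))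
    -- the inversion line lies in the domain of convergence of the transform
    (c : ℝ) (hc : 0 < c)
    (hconv : c < 2 * Λ ∨
      (2 * Λ < c ∧ (∀ᵐ ω ∂P', passageTime B ω < ∞) ∧
        Integrable (fun ω => Real.exp ((c - 2 * Λ) * (passageTime B ω).toReal)) P')) :
    -- the order is filled with no earlier mid-price move
    HasInverseLaplaceAt
      (fillTransform (laplace P' (passageTime D)) (laplace P' (passageTime B)) Λ) c 0
      (P'.real {ω | fillTime N i Q W ω < ∞ ∧ fillTime N i Q W ω ≤ nextMove N i Q ω} : ℝ) ∧
    -- if the fill does not itself empty the order's level: strictly before the next move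
    ((∀ᵐ ω ∂P', fillTime N i Q W ω < ∞ → fillTime N i Q W ω ≤ nextMove N i Q ω →
        shiftedBook N i Q (fillTime N i Q W ω).toNNReal ω (i.quote a b) ≠ 0) →
      HasInverseLaplaceAt
        (fillTransform (laplace P' (passageTime D)) (laplace P' (passageTime B)) Λ) c 0
        (P'.real {ω | fillTime N i Q W ω < nextMove N i Q ω} : ℝ)) := by
  have : IsProbabilityMeasure P' := hP' ▸ cond_isProbabilityMeasure hC
  -- The position starts at `m ≥ 1`, so its passage time has no atoms, and it is independent of the
  -- minimum over the other labels.
  have htie : ∀ᵐ ω ∂P', passageTime D ω ≠ ∞ →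
      passageTime D ω ≠ (otherDrivers s₀).inf fun e => driverTime D B T e ω :=
    ae_ne_of_indepFun (hflow.measurable_driverTime .position)
      (measurable_finset_inf hflow.measurable_driverTime _)
      (indepFun_finset_inf hflow.iIndepFun_driverTime hflow.measurable_driverTime
        (fun h => mem_otherDrivers.1 h rfl))
      (hflow.position_law.measure_passageTime_eq (by omega))
  have hpath := hflow.ae_isDrivenPath hQr hWr hm hn htie
  have hinv := hasInverseLaplaceAt_fillTransform (ε := passageTime D) (σ := passageTime B)
    (hflow.measurable_driverTime .position)
    (hflow.measurable_driverTime .opposite)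
    (measurable_finset_inf hflow.measurable_driverTime (otherDrivers s₀))
    (indepFun_finset_inf hflow.iIndepFun_driverTime hflow.measurable_driverTime
      (fun h => mem_otherDrivers.1 h rfl))
    (hflow.tail_inf hΛask hΛbid) htie hc hconv
  refine ⟨?_, fun hne => ?_⟩
  · convert hinv using 2
    refine measureReal_congr ?_
    filter_upwards [hpath] with ω hω
    exact propext (hω.fill_le_nextMid_iff hb ha hab)
  · convert hinv using 2
    refine measureReal_congr ?_
    filter_upwards [hpath, hne] with ω hω hω'
    exact propext (hω.fill_lt_nextMid_iff hb ha hab hω')
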